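/- Let $\Gamma$ be a countable discrete group acting measurably on a $\sigma$-finite measure space $(X,\nu)$ with $\nu\neq 0$, and assume that the action is measure-class-preserving, i.e. $\nu(A)=0$ implies $\nu(\gamma A)=0$ for all $\gamma\in\Gamma$. Let $r(\gamma,x)=\frac{d\gamma^{-1}_*\nu}{d\nu}(x)$ be the Radon–Nikodym derivatives, normalised on a null set so that $0<r(\gamma,x)<\infty$ everywhere. Definitions. A *domain* is a measurable set $Y\subseteq X$ with $0<\nu(Y)<\infty$. An *exhaustion* of $Y$ is a sequence of measurable sets $Y_1\subseteq Y_2\subseteq\dots\subseteq Y$ with $\nu(Y\setminus\bigcup_n Y_n)=0$. The action is *strongly ergodic* if for some (equivalently, every) probability measure $\mu$ equivalent to $\nu$, every sequence of measurable sets $C_n\subseteq X$ with $\lim_n\mu(C_n\triangle\gamma C_n)=0$ for all $\gamma\in\Gamma$ satisfies $\lim_n\mu(C_n)(1-\mu(C_n))=0$. If $\nu$ is a probability measure, the action is *asymptotically expanding in measure* if for every $\alpha\in(0,\frac12]$ there are $c>0$ and a finite symmetric $S\subseteq\Gamma$ such that $\nu(\bigcup_{s\in S}sA)>(1+c)\nu(A)$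 for every measurable $A$ with $\alpha\le\nu(A)\le\frac12$. For a measurable set $Y\subseteq X$, a finite symmetric $S\subseteq\Gamma$ with $1\in S$, and $x\in Y$, put $S_{Y,x}=\{s\in S: s\cdot x\in Y\}$, $\sigma_{Y,S}(x)=\sum_{s\in S_{Y,x}}r(s,x)^{1/2}$, $d\tilde\nu_{Y,S}=\sigma_{Y,S}\,d(\nu|_Y)$, and let $\Pi_{Y,S}$ be the Markov kernel on $Y$ given by $$\Pi_{Y,S}(x,-)=\frac1{\sigma_{Y,S}(x)}\sum_{s\in S_{Y,x}}r(s,x)^{1/2}\,\delta_{s\cdot x}.$$ A domain $Y$ is a *domain of Markov $S$-expansion* if the Cheeger constant $$\inf\left\{\frac{\int_A\Pi_{Y,S}(x,Y\setminus A)\,d\tilde\nu_{Y,S}(x)}{\tilde\nu_{Y,S}(A)}\;:\;A\subseteq Y\text{ measurable},\ 0<\tilde\nu_{Y,S}(A)\le\tfrac12\tilde\nu_{Y,S}(Y)\right\}$$ is strictly positive (with $\inf\emptyset=+\infty$), and a *domain of Markov expansion* if it is so for some finite symmetric $S\ni1$. Theorem. 1. The action is strongly ergodic if and only if every domain $Y\subseteq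 X$ admits an exhaustion by domains of Markov expansion. 2. If the action is strongly ergodic, then every domain $Y\subseteq X$ admits an exhaustion $(Y_n)$ for which there are finite symmetric sets $S^{(n)}\ni 1$ and constants $\Theta_n\ge1$ such that each $Y_n$ is a domain of Markov $S^{(n)}$-expansion and $1/\Theta_n\le r(s,y)\le\Theta_n$ for all $y\in Y_n$ and $s\in S^{(n)}_{Y_n,y}$. 3. If $\nu$ is a probability measure, then the action is strongly ergodic if and only if it is asymptotically expanding in measure. (So, by 1, on a probability space the action is asymptotically expanding in measure if and only if every domain admits an exhaustion by domains of Markov expansion.) -/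

import Mathlib

open MeasureTheory ProbabilityTheory Filter Topology
open scoped Pointwise NNReal ENNReal symmDiff

noncomputable section

namespace MarkovExpansion

/-! ### Reversible Markov kernels: size of the boundary, Cheeger constant -/

section Kernels

variable {α : Type*} [MeasurableSpace α]

/-- The `m`-size of the boundary of `A` with respect to the kernel `P`,
that is `∫_A P(x, Aᶜ) dm(x)`. -/
def boundarySize (P : Kernel α α) (m : Measure α) (A : Set α) : ℝ≥0∞ :=
  ∫⁻ x in A, P x Aᶜ ∂m

/-- The Cheeger constant of the kernel `P` on `(α, m)`: the infimum of `|∂A|_m / m(A)` over all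
measurable `A` with `0 < m(A) ≤ m(α)/2`. The infimum is taken in `[0, ∞]`; it is `∞` if there is no
such `A`. -/
def cheegerConstant (P : Kernel α α) (m : Measure α) : ℝ≥0∞ :=
  ⨅ A ∈ {A : Set α | MeasurableSet A ∧ 0 < m A ∧ m A ≤ m Set.univ / 2},
    boundarySize P m A / m A

end Kernels

variable {Γ X : Type*} [Group Γ] [MeasurableSpace X] [MulAction Γ X]

/-! ### Measure-class-preserving actions, domains, exhaustions -/

variable (Γ) in
/-- The action sends null sets to null sets. -/
def MeasureClassPreserving (ν : Measure X) : Prop :=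
  ∀ (γ : Γ) (A : Set X), ν A = 0 → ν (γ • A) = 0

/-- A domain is a measurable subset of positive finite measure. -/
def IsMeasureDomain (ν : Measure X) (Y : Set X) : Prop :=
  MeasurableSet Y ∧ 0 < ν Y ∧ ν Y < ∞

/-- An exhaustion of `Y`: nested measurable subsets of `Y` whose union is `Y` up to measure zero. -/
def IsExhaustion (ν : Measure X) (Y : Set X) (Z : ℕ → Set X) : Prop :=
  (∀ n, MeasurableSet (Z n)) ∧ Monotone Z ∧ (∀ n, Z n ⊆ Y) ∧ ν (Y \ ⋃ n, Z n) = 0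

/-! ### Strong ergodicity and asymptotic expansion in measure -/

variable (Γ) in
/-- Strong ergodicity of an action on a probability space. -/
def StronglyErgodicProb (μ : Measure X) : Prop :=
  ∀ C : ℕ → Set X, (∀ n, MeasurableSet (C n)) →
    (∀ γ : Γ, Tendsto (fun n => μ.real (C n ∆ (γ • C n))) atTop (𝓝 0)) →
    Tendsto (fun n => μ.real (C n) * (1 - μ.real (C n))) atTop (𝓝 0)

variable (Γ) in
/-- Strong ergodicity of an action on a (possibly infinite) measure space: the action is strongly
ergodic with respect to some probability measure in the measure class of `ν`. -/
def StronglyErgodic (ν : Measure X) : Prop :=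
  ∃ μ : Measure X, IsProbabilityMeasure μ ∧ μ ≪ ν ∧ ν ≪ μ ∧ StronglyErgodicProb Γ μ

variable (Γ) in
/-- Asymptotic expansion in measure of an action on a space of finite measure. -/
def AsymptoticallyExpanding (ν : Measure X) : Prop :=
  ∀ a : ℝ, 0 < a → a ≤ 1 / 2 → ∃ c : ℝ, 0 < c ∧ ∃ S : Finset Γ, (∀ s ∈ S, s⁻¹ ∈ S) ∧
    ∀ A : Set X, MeasurableSet A → a * ν.real Set.univ ≤ ν.real A →
      ν.real A ≤ ν.real Set.univ / 2 → (1 + c) * ν.real A < ν.real (⋃ s ∈ S, s • A)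

/-! ### The normalised local Markov kernel of an action -/

open Classical in
/-- The Radon–Nikodym derivative `r(γ, x) = (d γ⁻¹_* ν / dν)(x)`. For a measure-class-preserving
action on a σ-finite space it lies in `(0, ∞)` for almost every `x`; on the remaining null set it is
given the value `1`, so that it is positive and finite everywhere. -/
def rnd (ν : Measure X) (γ : Γ) (x : X) : ℝ≥0 :=
  if (ν.map (fun z => γ⁻¹ • z)).rnDeriv ν x = 0 ∨ (ν.map (fun z => γ⁻¹ • z)).rnDeriv ν x = ∞
  then 1 else ((ν.map (fun z => γ⁻¹ • z)).rnDeriv ν x).toNNReal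

lemma rnd_pos (ν : Measure X) (γ : Γ) (x : X) : 0 < rnd ν γ x := by
  unfold rnd
  split_ifs with h
  · exact one_pos
  · push Not at h
    exact ENNReal.toNNReal_pos h.1 h.2

lemma measurable_rnd (ν : Measure X) (γ : Γ) : Measurable (rnd ν γ) := by
  unfold rnd
  have h := Measure.measurable_rnDeriv (ν.map (fun z => γ⁻¹ • z)) ν
  exact Measurable.ite ((measurableSet_eq_fun h measurable_const).union
    (measurableSet_eq_fun h measurable_const)) measurable_const h.ennreal_toNNReal

open Classical in
/-- The set `S_{Y,x}` of all `s ∈ S` with `s • x ∈ Y`. -/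
def localSet (Y : Set X) (S : Finset Γ) (x : X) : Finset Γ :=
  S.filter (fun s => s • x ∈ Y)

/-- The function `σ_{Y,S}(x) = ∑_{s ∈ S_{Y,x}} r(s,x)^{1/2}`. -/
def sigma (ν : Measure X) (Y : Set X) (S : Finset Γ) (x : X) : ℝ≥0 :=
  ∑ s ∈ localSet Y S x, NNReal.sqrt (rnd ν s x)

/-- The measure `σ_{Y,S} · ν|_Y` on `Y`. -/
def reversingMeasure (ν : Measure X) (Y : Set X) (S : Finset Γ) : Measure Y :=
  (ν.comap Subtype.val).withDensity (fun x => (sigma ν Y S x : ℝ≥0∞))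

/-- The value at `x ∈ Y` of the normalised local Markov kernel, that is
`σ_{Y,S}(x)⁻¹ ∑_{s ∈ S_{Y,x}} r(s,x)^{1/2} δ_{s • x}`, a measure on `Y`. -/
def localKernelFun (ν : Measure X) (Y : Set X) (S : Finset Γ) (x : Y) : Measure Y :=
  ∑ s ∈ (localSet Y S (x : X)).attach,
    ((NNReal.sqrt (rnd ν s.1 (x : X)) / sigma ν Y S (x : X) : ℝ≥0) : ℝ≥0∞) •
      Measure.dirac (⟨s.1 • (x : X), by
        have h := s.2
        simp only [localSet, Finset.mem_filter] at h
        exact h.2⟩ : Y)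

open Classical in
lemma sigma_eq (ν : Measure X) (Y : Set X) (S : Finset Γ) (x : X) :
    sigma ν Y S x = ∑ s ∈ S, if s • x ∈ Y then NNReal.sqrt (rnd ν s x) else 0 := by
  simp only [sigma, localSet, Finset.sum_filter]

lemma measurable_sigma [MeasurableConstSMul Γ X] (ν : Measure X) {Y : Set X}
    (hY : MeasurableSet Y) (S : Finset Γ) : Measurable (sigma ν Y S) := by
  classical
  have h : sigma ν Y S =
      fun x => ∑ s ∈ S, if s • x ∈ Y then NNReal.sqrt (rnd ν s x) else 0 :=
    funext (sigma_eq ν Y S)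
  rw [h]
  refine Finset.measurable_sum _ fun s _ => ?_
  exact Measurable.ite (measurable_const_smul s hY)
    (NNReal.continuous_sqrt.measurable.comp (measurable_rnd ν s)) measurable_const

open Classical in
lemma localKernelFun_apply (ν : Measure X) (Y : Set X) (S : Finset Γ) (x : Y) {B : Set X}
    (hB : MeasurableSet B) :
    localKernelFun ν Y S x (Subtype.val ⁻¹' B) = ∑ s ∈ S, if s • (x : X) ∈ Y ∩ B then
      ((NNReal.sqrt (rnd ν s (x : X)) / sigma ν Y S (x : X) : ℝ≥0) : ℝ≥0∞) else 0 := by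
  have hB' : MeasurableSet (Subtype.val ⁻¹' B : Set Y) := measurable_subtype_coe hB
  simp only [localKernelFun, Measure.coe_finsetSum, Finset.sum_apply, Measure.smul_apply,
    Measure.dirac_apply' _ hB', smul_eq_mul]
  rw [← Finset.sum_filter_add_sum_filter_not S (fun s => s • (x : X) ∈ Y)]
  rw [Finset.sum_eq_zero (s := S.filter (fun s => ¬ s • (x : X) ∈ Y)), add_zero]
  · change _ = ∑ s ∈ localSet Y S (x : X), _
    rw [← Finset.sum_attach (localSet Y S (x : X))]
    refine Finset.sum_congr rfl fun s _ => ?_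
    have hs : s.1 • (x : X) ∈ Y := by
      have h := s.2
      simp only [localSet, Finset.mem_filter] at h
      exact h.2
    by_cases hx : s.1 • (x : X) ∈ B
    · simp [Set.indicator, hx, hs]
    · simp [Set.indicator, hx]
  · intro s hs
    rw [if_neg]
    exact fun h => (Finset.mem_filter.1 hs).2 h.1

/-- The normalised local Markov kernel `Π_{Y,S}` on the measurable set `Y`. -/
def localKernel [MeasurableConstSMul Γ X] (ν : Measure X) {Y : Set X} (hY : MeasurableSet Y)
    (S : Finset Γ) : Kernel Y Y where
  toFun := localKernelFun ν Y S
  measurable' := by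
    classical
    refine Measure.measurable_of_measurable_coe _ fun B hB => ?_
    obtain ⟨B', hB', rfl⟩ := hB
    simp only [localKernelFun_apply ν Y S _ hB']
    refine Finset.measurable_sum _ fun s _ => ?_
    refine Measurable.ite ?_ (Measurable.coe_nnreal_ennreal (Measurable.div ?_ ?_))
      measurable_const
    · exact ((measurable_const_smul s).comp measurable_subtype_coe) (hY.inter hB')
    · exact NNReal.continuous_sqrt.measurable.comp
        ((measurable_rnd ν s).comp measurable_subtype_coe)
    · exact (measurable_sigma ν hY S).comp measurable_subtype_coe

/-- If `1 ∈ S`, then `Π_{Y,S}` is a Markov kernel. -/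
lemma isMarkovKernel_localKernel [MeasurableConstSMul Γ X] (ν : Measure X) {Y : Set X}
    (hY : MeasurableSet Y) {S : Finset Γ} (hS : (1 : Γ) ∈ S) :
    IsMarkovKernel (localKernel ν hY S) := by
  classical
  refine ⟨fun x => ⟨?_⟩⟩
  have hpos : sigma ν Y S (x : X) ≠ 0 := by
    rw [sigma_eq]
    refine (Finset.sum_pos' (fun s _ => zero_le) ⟨1, hS, ?_⟩).ne'
    simpa using rnd_pos ν (1 : Γ) (x : X)
  change localKernelFun ν Y S x Set.univ = 1
  have h := localKernelFun_apply ν Y S x MeasurableSet.univ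
  rw [Set.preimage_univ] at h
  rw [h]
  simp only [Set.inter_univ]
  have h2 : (∑ s ∈ S, if s • (x : X) ∈ Y then
      NNReal.sqrt (rnd ν s (x : X)) / sigma ν Y S (x : X) else 0) = 1 := by
    have h3 : ∀ s ∈ S, (if s • (x : X) ∈ Y then
        NNReal.sqrt (rnd ν s (x : X)) / sigma ν Y S (x : X) else 0) =
        (if s • (x : X) ∈ Y then NNReal.sqrt (rnd ν s (x : X)) else 0) / sigma ν Y S (x : X) := by
      intro s _
      split_ifs <;> simp
    rw [Finset.sum_congr rfl h3, ← Finset.sum_div, ← sigma_eq, div_self hpos]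
  rw [← ENNReal.coe_one, ← h2, ENNReal.ofNNReal_finsetSum]
  refine Finset.sum_congr rfl fun s _ => ?_
  split_ifs <;> simp

/-! ### Domains of Markov expansion -/

/-- `Y` is a domain of Markov `S`-expansion, where `S` is finite and symmetric with `1 ∈ S`: the
normalised local Markov kernel on `Y`, with its reversing measure, has positive Cheeger constant. -/
def IsDomainOfMarkovExpansionFor [MeasurableConstSMul Γ X] (ν : Measure X) (S : Finset Γ)
    (Y : Set X) : Prop :=
  ∃ hY : IsMeasureDomain ν Y, (1 : Γ) ∈ S ∧ (∀ s ∈ S, s⁻¹ ∈ S) ∧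
    0 < cheegerConstant (localKernel ν hY.1 S) (reversingMeasure ν Y S)

variable (Γ) in
/-- `Y` is a domain of Markov expansion. -/
def IsDomainOfMarkovExpansion [MeasurableConstSMul Γ X] (ν : Measure X) (Y : Set X) : Prop :=
  ∃ S : Finset Γ, IsDomainOfMarkovExpansionFor ν S Y

end MarkovExpansion

end

open MeasureTheory ProbabilityTheory Filter Topology
open scoped Pointwise NNReal ENNReal symmDiff

namespace MarkovExpansion

/-! ### Absolute continuity in epsilon-delta form -/

section General

variable {α : Type*} [MeasurableSpace α]

/-! Every limit statement depends only on the measure class: a finite measure `ρ ≪ ν` has an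
integrable density, so `ν (B n) → 0` forces `ρ (B n) → 0`. Hence almost invariance may be tested
with any convenient measure, and group elements preserve convergence to zero.

From Markov expansion to strong ergodicity: `σ` cancels in the flux `∫_A Π(x, Aᶜ) dν̃`, which
becomes a sum over `s` of integrals of `r(s,x)^{1/2}` over the points that `s` moves out of `A`. For
`A = C n ∩ Z`, or its complement in `Z`, these points lie in `C n ∆ s⁻¹ C n`, and the weights define
finite measures. So the flux of an almost invariant sequence vanishes, and a positive Cheeger
constant makes `C n` trivial on `Z`. Domains exhaust `X` up to small measure.

From strong ergodicity to Markov expansion there are four ingredients. Localisation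
(`StronglyErgodic.exists_le_crossing`): sets almost invariant inside `Y` extend to almost invariant
subsets of `X` by a first-hitting rule, so cuts of `Y` into two non-small pieces have crossing
bounded below. Trimming (`exists_isIsoperimetric_sdiff`): deleting a maximal set of small boundary
turns this into a linear isoperimetric inequality. Gluing (`IsIsoperimetric.union`): this inequality
passes to unions with non-null overlap, which makes the trimmed sets nested. Comparison
(`IsIsoperimetric.exists_isDomainOfMarkovExpansionFor`): where the derivatives are bounded, `ν` and
the reversing measure are comparable, so isoperimetry is Markov expansion.

The equivalence with asymptotic expansion is direct: failure of expansion along an exhaustion of `Γ`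
produces a nontrivial almost invariant sequence, and expansion excludes one. -/

lemma exists_pos_forall_measure_lt {ρ ν : Measure α} [IsFiniteMeasure ρ] [SigmaFinite ν]
    (h : ρ ≪ ν) {ε : ℝ≥0∞} (hε : ε ≠ 0) : ∃ δ > 0, ∀ s, ν s < δ → ρ s < ε := by
  have hfin : ∫⁻ x, ρ.rnDeriv ν x ∂ν ≠ ∞ := by
    rw [Measure.lintegral_rnDeriv h]
    exact measure_ne_top ρ _
  obtain ⟨δ, hδ, H⟩ := exists_pos_setLIntegral_lt_of_measure_lt hfin hε
  refine ⟨δ, hδ, fun s hs => ?_⟩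
  rw [← Measure.setLIntegral_rnDeriv h]
  exact H s hs

lemma tendsto_measure_zero_of_absolutelyContinuous {ι : Type*} {l : Filter ι} {ρ ν : Measure α}
    [IsFiniteMeasure ρ] [SigmaFinite ν] (h : ρ ≪ ν) {B : ι → Set α}
    (hB : Tendsto (fun i => ν (B i)) l (𝓝 0)) : Tendsto (fun i => ρ (B i)) l (𝓝 0) := by
  rw [ENNReal.tendsto_nhds_zero]
  intro ε hε
  obtain ⟨δ, hδ, H⟩ := exists_pos_forall_measure_lt h hε.ne'
  filter_upwards [hB.eventually_lt_const hδ] with i hi using (H _ hi).le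

end General

/-! ### Radon–Nikodym derivatives and the flux of the local kernel -/

section Action

variable {Γ X : Type*} [Group Γ] [MeasurableSpace X] [MulAction Γ X]

lemma reversingMeasure_preimage (ν : Measure X) {Y : Set X} (hY : MeasurableSet Y) (S : Finset Γ)
    {B : Set X} (hB : MeasurableSet B) (hBY : B ⊆ Y) :
    reversingMeasure ν Y S (Subtype.val ⁻¹' B) = ∫⁻ x in B, sigma ν Y S x ∂ν := by
  rw [reversingMeasure, withDensity_apply _ (measurable_subtype_coe hB),
    setLIntegral_subtype hY _ (fun x => (sigma ν Y S x : ℝ≥0∞)), Subtype.image_preimage_coe,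
    Set.inter_eq_right.2 hBY]

lemma sigma_pos (ν : Measure X) {Y : Set X} {S : Finset Γ} (hS : (1 : Γ) ∈ S) {x : X}
    (hx : x ∈ Y) : 0 < sigma ν Y S x := by
  classical
  rw [sigma_eq]
  refine Finset.sum_pos' (fun s _ => zero_le) ⟨1, hS, ?_⟩
  simpa [hx] using rnd_pos ν (1 : Γ) x

variable [MeasurableConstSMul Γ X]

lemma MeasureClassPreserving.map_absolutelyContinuous {ν μ : Measure X}
    (hΓ : MeasureClassPreserving Γ ν) (h : μ ≪ ν) (γ : Γ) :
    μ.map (fun x => γ • x) ≪ ν := by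
  refine Measure.AbsolutelyContinuous.mk fun s hs h0 => ?_
  rw [Measure.map_apply (measurable_const_smul γ) hs, Set.preimage_smul]
  exact h (hΓ γ⁻¹ s h0)

lemma MeasureClassPreserving.absolutelyContinuous_map {ν : Measure X}
    (hΓ : MeasureClassPreserving Γ ν) (γ : Γ) : ν ≪ ν.map (fun x => γ • x) := by
  refine Measure.AbsolutelyContinuous.mk fun s hs h0 => ?_
  rw [Measure.map_apply (measurable_const_smul γ) hs, Set.preimage_smul] at h0
  simpa using hΓ γ _ h0

lemma sigmaFinite_map_smul (ν : Measure X) [SigmaFinite ν] (γ : Γ) :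
    SigmaFinite (ν.map (fun x => γ • x)) :=
  (MeasurableEquiv.smul γ).sigmaFinite_map

lemma MeasureClassPreserving.rnd_ae_eq {ν : Measure X} [SigmaFinite ν]
    (hΓ : MeasureClassPreserving Γ ν) (γ : Γ) :
    ∀ᵐ x ∂ν, (rnd ν γ x : ℝ≥0∞) = (ν.map (fun z => γ⁻¹ • z)).rnDeriv ν x := by
  have := sigmaFinite_map_smul ν γ⁻¹
  have h1 := Measure.rnDeriv_ne_top (ν.map (fun z => γ⁻¹ • z)) ν
  have h2 := Measure.rnDeriv_pos' (hΓ.absolutelyContinuous_map γ⁻¹)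
  filter_upwards [h1, h2] with x hx1 hx2
  unfold rnd
  rw [if_neg (by simp [hx1, hx2.ne']), ENNReal.coe_toNNReal hx1]

/-- The preimage on the right is `γ • E`: this is the change of variables that moves mass along `γ`.
-/
lemma MeasureClassPreserving.setLIntegral_rnd {ν : Measure X} [SigmaFinite ν]
    (hΓ : MeasureClassPreserving Γ ν) (γ : Γ) {E : Set X} (hE : MeasurableSet E) :
    ∫⁻ x in E, rnd ν γ x ∂ν = ν ((fun x => γ⁻¹ • x) ⁻¹' E) := by
  have := sigmaFinite_map_smul ν γ⁻¹
  rw [lintegral_congr_ae (ae_restrict_of_ae (hΓ.rnd_ae_eq γ)), Measure.setLIntegral_rnDeriv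
    (hΓ.map_absolutelyContinuous Measure.AbsolutelyContinuous.rfl γ⁻¹),
    Measure.map_apply (measurable_const_smul γ⁻¹) hE]

lemma MeasureClassPreserving.rnd_one_ae_eq {ν : Measure X} [SigmaFinite ν]
    (hΓ : MeasureClassPreserving Γ ν) : ∀ᵐ x ∂ν, rnd ν (1 : Γ) x = 1 := by
  have h := hΓ.rnd_ae_eq (1 : Γ)
  simp only [inv_one, one_smul, Measure.map_id'] at h
  filter_upwards [h, ν.rnDeriv_self] with x h1 h2
  rw [h2] at h1
  exact_mod_cast h1

/-- The density `σ` of the reversing measure cancels the normalisation of the kernel. -/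
lemma boundarySize_localKernel (ν : Measure X) {Y : Set X} (hY : MeasurableSet Y) {S : Finset Γ}
    (hS : (1 : Γ) ∈ S) {B : Set X} (hB : MeasurableSet B) (hBY : B ⊆ Y) :
    boundarySize (localKernel ν hY S) (reversingMeasure ν Y S) (Subtype.val ⁻¹' B) =
      ∑ s ∈ S, ∫⁻ x in B ∩ (fun x => s • x) ⁻¹' (Y \ B), NNReal.sqrt (rnd ν s x) ∂ν := by
  classical
  have hm : ∀ s : Γ, Measurable fun x => (NNReal.sqrt (rnd ν s x) : ℝ≥0∞) := fun s =>
    (NNReal.continuous_sqrt.measurable.comp (measurable_rnd ν s)).coe_nnreal_ennreal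
  have hE : ∀ s : Γ, MeasurableSet ((fun x : X => s • x) ⁻¹' (Y \ B)) := fun s =>
    measurable_const_smul s (hY.diff hB)
  have hB' : MeasurableSet (Subtype.val ⁻¹' B : Set Y) := measurable_subtype_coe hB
  have hc : (Subtype.val ⁻¹' B : Set Y)ᶜ = Subtype.val ⁻¹' (Y \ B) := by ext x; simp
  rw [boundarySize, reversingMeasure, setLIntegral_withDensity_eq_setLIntegral_mul _
    (f := fun x : Y => (sigma ν Y S x : ℝ≥0∞))
    ((measurable_sigma ν hY S).comp measurable_subtype_coe).coe_nnreal_ennreal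
    (Kernel.measurable_coe (localKernel ν hY S) hB'.compl) hB', hc]
  have key : ∀ x : Y, ((fun x : Y => (sigma ν Y S x : ℝ≥0∞)) *
      fun x => localKernel ν hY S x (Subtype.val ⁻¹' (Y \ B))) x =
      ∑ s ∈ S, ((fun x => s • x) ⁻¹' (Y \ B)).indicator
        (fun x => (NNReal.sqrt (rnd ν s x) : ℝ≥0∞)) (x : X) := by
    intro x
    change (sigma ν Y S x : ℝ≥0∞) * localKernelFun ν Y S x (Subtype.val ⁻¹' (Y \ B)) = _
    rw [localKernelFun_apply ν Y S x (hY.diff hB), Finset.mul_sum]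
    refine Finset.sum_congr rfl fun s _ => ?_
    have hpos := (sigma_pos ν hS x.2).ne'
    by_cases hx : s • (x : X) ∈ Y \ B
    · rw [if_pos ⟨hx.1, hx⟩, Set.indicator_of_mem (by exact hx), ← ENNReal.coe_mul,
        mul_div_cancel₀ _ hpos]
    · rw [if_neg (fun h => hx h.2), Set.indicator_of_notMem (by exact hx), mul_zero]
  rw [lintegral_congr key, setLIntegral_subtype hY _ (fun x => ∑ s ∈ S,
    ((fun x => s • x) ⁻¹' (Y \ B)).indicator (fun x => (NNReal.sqrt (rnd ν s x) : ℝ≥0∞)) x),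
    Subtype.image_preimage_coe, Set.inter_eq_right.2 hBY,
    lintegral_finsetSum _ fun s _ => (hm s).indicator (hE s)]
  refine Finset.sum_congr rfl fun s _ => ?_
  rw [lintegral_indicator (hE s), Measure.restrict_restrict (hE s), Set.inter_comm]

end Action

end MarkovExpansion

namespace MarkovExpansion

/-! ### Strong ergodicity within a measure class -/

section Basic

variable {Γ X : Type*} [Group Γ] [MeasurableSpace X] [MulAction Γ X]

lemma tendsto_min_measure_compl_of_absolutelyContinuous {ι : Type*} {l : Filter ι}
    {ρ ν : Measure X} [IsFiniteMeasure ρ] [SigmaFinite ν] (h : ρ ≪ ν) {C : ι → Set X}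
    (hC : Tendsto (fun i => min (ν (C i)) (ν (C i)ᶜ)) l (𝓝 0)) :
    Tendsto (fun i => min (ρ (C i)) (ρ (C i)ᶜ)) l (𝓝 0) := by
  rw [ENNReal.tendsto_nhds_zero]
  intro ε hε
  obtain ⟨δ, hδ, H⟩ := exists_pos_forall_measure_lt h hε.ne'
  filter_upwards [hC.eventually_lt_const hδ] with i hi
  rcases min_lt_iff.1 hi with hi | hi
  · exact (min_le_left _ _).trans (H _ hi).le
  · exact (min_le_right _ _).trans (H _ hi).le

/-- For `0 ≤ p ≤ 1`, `p (1 - p) ≤ min p (1 - p) ≤ 2 p (1 - p)`. The minimum is the form that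
transfers between equivalent measures. -/
lemma tendsto_min_measure_compl_iff {ι : Type*} {l : Filter ι} (μ : Measure X)
    [IsProbabilityMeasure μ] {C : ι → Set X} (hC : ∀ i, MeasurableSet (C i)) :
    Tendsto (fun i => min (μ (C i)) (μ (C i)ᶜ)) l (𝓝 0) ↔
      Tendsto (fun i => μ.real (C i) * (1 - μ.real (C i))) l (𝓝 0) := by
  have h1 : Tendsto (fun i => min (μ (C i)) (μ (C i)ᶜ)) l (𝓝 0) ↔
      Tendsto (fun i => min (μ.real (C i)) (1 - μ.real (C i))) l (𝓝 0) := by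
    rw [← ENNReal.tendsto_toReal_zero_iff (fun i => ((min_le_left _ _).trans_lt
      (measure_lt_top μ (C i))).ne)]
    refine iff_of_eq (congrArg (fun f => Tendsto f l (𝓝 0)) (funext fun i => ?_))
    rw [ENNReal.toReal_min (measure_ne_top _ _) (measure_ne_top _ _),
      ← probReal_compl_eq_one_sub (hC i)]
    rfl
  have h0 : ∀ i, 0 ≤ μ.real (C i) := fun i => measureReal_nonneg
  have h0' : ∀ i, 0 ≤ 1 - μ.real (C i) := fun i => sub_nonneg.2 measureReal_le_one
  rw [h1]
  constructor <;> intro h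
  · refine squeeze_zero (fun i => mul_nonneg (h0 i) (h0' i)) (fun i => le_min ?_ ?_) h
    · nlinarith [h0 i, h0' i]
    · nlinarith [h0 i, h0' i]
  · refine squeeze_zero (fun i => le_min (h0 i) (h0' i)) (fun i => ?_)
      (by simpa using h.const_mul 2)
    rcases le_total (μ.real (C i)) (1 - μ.real (C i)) with hi | hi
    · rw [min_eq_left hi]
      nlinarith [h0 i, h0' i]
    · rw [min_eq_right hi]
      nlinarith [h0 i, h0' i]

/-- Strong ergodicity may be tested with any finite measures in the measure class. -/
lemma StronglyErgodic.tendsto_min {ν : Measure X} [SigmaFinite ν] (h : StronglyErgodic Γ ν)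
    {ρ ρ' : Measure X} [SigmaFinite ρ] [IsFiniteMeasure ρ'] (hρ : ν ≪ ρ) (hρ' : ρ' ≪ ν)
    {C : ℕ → Set X} (hC : ∀ n, MeasurableSet (C n))
    (hinv : ∀ γ : Γ, Tendsto (fun n => ρ (C n ∆ (γ • C n))) atTop (𝓝 0)) :
    Tendsto (fun n => min (ρ' (C n)) (ρ' (C n)ᶜ)) atTop (𝓝 0) := by
  obtain ⟨μ, hμ, hμν, hνμ, H⟩ := h
  refine tendsto_min_measure_compl_of_absolutelyContinuous (hρ'.trans hνμ) ?_
  rw [tendsto_min_measure_compl_iff μ hC]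
  refine H C hC fun γ => ?_
  rw [← ENNReal.toReal_zero]
  exact (ENNReal.tendsto_toReal ENNReal.zero_ne_top).comp
    (tendsto_measure_zero_of_absolutelyContinuous (hμν.trans hρ) (hinv γ))

lemma stronglyErgodic_of_tendsto_min {ν : Measure X} [SigmaFinite ν] (hν : ν ≠ 0)
    (h : ∀ C : ℕ → Set X, (∀ n, MeasurableSet (C n)) →
      (∀ γ : Γ, Tendsto (fun n => ν.toFinite (C n ∆ (γ • C n))) atTop (𝓝 0)) →
      Tendsto (fun n => min (ν.toFinite (C n)) (ν.toFinite (C n)ᶜ)) atTop (𝓝 0)) :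
    StronglyErgodic Γ ν := by
  have : NeZero ν := ⟨hν⟩
  refine ⟨ν.toFinite, inferInstance, toFinite_absolutelyContinuous ν,
    absolutelyContinuous_toFinite ν, fun C hC hinv => ?_⟩
  rw [← tendsto_min_measure_compl_iff _ hC]
  refine h C hC fun γ => ?_
  rw [← ENNReal.tendsto_toReal_zero_iff (fun i => measure_ne_top _ _)]
  exact hinv γ

/-! ### Asymptotic expansion in measure -/

/-- Take whichever of `C n` and its complement has measure at most `1/2`. If its measure were at
least `a`, its `S`-translates would add more than `c * a`, whereas almost invariance eventually
allows less. -/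
lemma AsymptoticallyExpanding.stronglyErgodic {ν : Measure X} [IsProbabilityMeasure ν]
    (h : AsymptoticallyExpanding Γ ν) : StronglyErgodic Γ ν := by
  refine stronglyErgodic_of_tendsto_min (IsProbabilityMeasure.ne_zero ν) ?_
  rw [toFinite_eq_self]
  intro C hC hinv
  rw [ENNReal.tendsto_nhds_zero]
  intro ε hε
  obtain ⟨a, ha0, ha2, haε⟩ : ∃ a : ℝ, 0 < a ∧ a ≤ 1 / 2 ∧ ENNReal.ofReal a ≤ ε := by
    rcases eq_or_ne ε ∞ with rfl | hε'
    · exact ⟨1 / 2, by norm_num, le_rfl, le_top⟩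
    · refine ⟨min ε.toReal (1 / 2), lt_min (ENNReal.toReal_pos hε.ne' hε') (by norm_num),
        min_le_right _ _, ENNReal.ofReal_le_of_le_toReal (min_le_left _ _)⟩
  obtain ⟨c, hc, S, -, H⟩ := h a ha0 ha2
  simp only [probReal_univ, mul_one] at H
  have hsum : Tendsto (fun n => ∑ s ∈ S, ν.real (C n ∆ (s • C n))) atTop (𝓝 0) := by
    rw [← Finset.sum_const_zero (s := S)]
    refine tendsto_finsetSum _ fun s _ => ?_
    exact (ENNReal.tendsto_toReal_zero_iff (fun i => measure_ne_top _ _)).2 (hinv s)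
  have key : ∀ n, ∀ A : Set X, MeasurableSet A →
      (∀ s : Γ, (s • A) \ A ⊆ C n ∆ (s • C n)) → ν.real A ≤ 1 / 2 →
      ∑ s ∈ S, ν.real (C n ∆ (s • C n)) < c * a → ν.real A < a := by
    intro n A hA hsub hA2 hlt
    by_contra! hAa
    have h1 := H A hA hAa hA2
    have h2 : ν.real (⋃ s ∈ S, s • A) ≤ ν.real A + ∑ s ∈ S, ν.real (C n ∆ (s • C n)) := by
      have hincl : (⋃ s ∈ S, s • A) ⊆ A ∪ ⋃ s ∈ S, C n ∆ (s • C n) := by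
        intro x hx
        simp only [Set.mem_iUnion, exists_prop] at hx
        obtain ⟨s, hs, hx⟩ := hx
        by_cases hxA : x ∈ A
        · exact Or.inl hxA
        · exact Or.inr (Set.mem_biUnion (show s ∈ (S : Set Γ) from hs) (hsub s ⟨hx, hxA⟩))
      refine (measureReal_mono hincl).trans ((measureReal_union_le _ _).trans ?_)
      gcongr
      exact measureReal_biUnion_finset_le _ _
    nlinarith
  filter_upwards [hsum.eventually_lt_const (mul_pos hc ha0)] with n hn
  refine le_trans ?_ haε
  rcases le_total (ν.real (C n)) (1 / 2) with h2 | h2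
  · refine (min_le_left _ _).trans ?_
    rw [← ENNReal.ofReal_toReal (measure_ne_top ν (C n))]
    refine ENNReal.ofReal_le_ofReal (key n (C n) (hC n) (fun s => ?_) h2 hn).le
    exact fun x hx => Or.inr hx
  · refine (min_le_right _ _).trans ?_
    rw [← ENNReal.ofReal_toReal (measure_ne_top ν (C n)ᶜ)]
    refine ENNReal.ofReal_le_ofReal (key n (C n)ᶜ (hC n).compl (fun s => ?_) ?_ hn).le
    · intro x hx
      rw [Set.smul_set_compl] at hx
      exact Or.inl ⟨not_not.1 hx.2, hx.1⟩
    · rw [probReal_compl_eq_one_sub (hC n)]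
      linarith

variable [MeasurableConstSMul Γ X]

lemma measurableSet_smul_set (γ : Γ) {A : Set X} (hA : MeasurableSet A) :
    MeasurableSet (γ • A) := by
  rw [← Set.preimage_smul_inv]
  exact measurable_const_smul γ⁻¹ hA

lemma MeasureClassPreserving.tendsto_measure_smul {ι : Type*} {l : Filter ι} {ν ρ : Measure X}
    [SigmaFinite ν] [IsFiniteMeasure ρ] (hΓ : MeasureClassPreserving Γ ν) (hρ : ρ ≪ ν) (γ : Γ)
    {B : ι → Set X} (hm : ∀ i, MeasurableSet (B i))
    (hB : Tendsto (fun i => ν (B i)) l (𝓝 0)) :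
    Tendsto (fun i => ρ (γ • B i)) l (𝓝 0) := by
  have h := tendsto_measure_zero_of_absolutelyContinuous
    (hΓ.map_absolutelyContinuous hρ γ⁻¹) hB
  refine h.congr fun i => ?_
  rw [Measure.map_apply (measurable_const_smul γ⁻¹) (hm i), Set.preimage_smul_inv]

lemma StronglyErgodic.asymptoticallyExpanding [Countable Γ] {ν : Measure X}
    [IsProbabilityMeasure ν] (hΓ : MeasureClassPreserving Γ ν) (h : StronglyErgodic Γ ν) :
    AsymptoticallyExpanding Γ ν := by
  classical
  intro a ha ha2
  by_contra! hcon
  obtain ⟨e, he⟩ := exists_surjective_nat Γ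
  let S : ℕ → Finset Γ := fun n =>
    (Finset.range n).image e ∪ ((Finset.range n).image e).image (·⁻¹)
  have hS : ∀ n, ∀ s ∈ S n, s⁻¹ ∈ S n := by
    intro n s hs
    simp only [S, Finset.mem_union, Finset.mem_image] at hs ⊢
    rcases hs with hs | ⟨t, ht, rfl⟩
    · exact Or.inr ⟨s, hs, rfl⟩
    · exact Or.inl (by simpa using ht)
  have hmem : ∀ γ : Γ, ∀ᶠ n in atTop, γ ∈ S n := by
    intro γ
    obtain ⟨k, rfl⟩ := he γ
    filter_upwards [eventually_gt_atTop k] with n hn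
    exact Finset.mem_union_left _ (Finset.mem_image_of_mem e (Finset.mem_range.2 hn))
  -- The `n`-th counterexample defeats `S n` and `c = 1/(n+1)`. Once `1 ∈ S n`, each `γ • A n` with
  -- `γ ∈ S n` leaves `A n` by at most `1/(n+1)`.
  choose A hAm hA1 hA2 hA3 using fun n : ℕ => hcon (1 / ((n : ℝ) + 1)) (by positivity) (S n) (hS n)
  simp only [probReal_univ, mul_one] at hA1 hA2
  have hout : ∀ γ : Γ, Tendsto (fun n => ν ((γ • A n) \ A n)) atTop (𝓝 0) := by
    intro γ
    rw [← ENNReal.tendsto_toReal_zero_iff (fun i => measure_ne_top _ _)]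
    refine squeeze_zero' (Eventually.of_forall fun n => ENNReal.toReal_nonneg) ?_
      tendsto_one_div_add_atTop_nhds_zero_nat
    filter_upwards [hmem γ, hmem 1] with n hn h1
    change ν.real ((γ • A n) \ A n) ≤ _
    have hsub : A n ⊆ ⋃ s ∈ S n, s • A n := by
      have := Set.subset_biUnion_of_mem (u := fun s : Γ => s • A n) h1
      simpa using this
    have hle : ν.real ((γ • A n) \ A n) ≤ ν.real ((⋃ s ∈ S n, s • A n) \ A n) :=
      measureReal_mono (Set.sdiff_subset_sdiff_left
        (Set.subset_biUnion_of_mem (u := fun s : Γ => s • A n) hn))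
    rw [measureReal_sdiff hsub (hAm n) (measure_ne_top _ _)] at hle
    have hp : (0 : ℝ) < 1 / ((n : ℝ) + 1) := by positivity
    nlinarith [hA3 n, hA2 n]
  have hinv : ∀ γ : Γ, Tendsto (fun n => ν (A n ∆ (γ • A n))) atTop (𝓝 0) := by
    intro γ
    -- The other half of the symmetric difference is `A n \ γ • A n = γ • (γ⁻¹ • A n \ A n)`.
    have h2 := hΓ.tendsto_measure_smul Measure.AbsolutelyContinuous.rfl γ
      (fun n => (measurableSet_smul_set γ⁻¹ (hAm n)).diff (hAm n)) (hout γ⁻¹)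
    have h3 := h2.add (hout γ)
    rw [add_zero] at h3
    refine tendsto_of_tendsto_of_tendsto_of_le_of_le tendsto_const_nhds h3
      (fun n => zero_le) fun n => ?_
    refine (measure_mono ?_).trans (measure_union_le _ _)
    rw [Set.smul_set_sdiff, smul_inv_smul]
    exact subset_rfl
  have hlim := h.tendsto_min (ρ := ν) (ρ' := ν) Measure.AbsolutelyContinuous.rfl
    Measure.AbsolutelyContinuous.rfl hAm hinv
  obtain ⟨n, hn⟩ := (hlim.eventually_lt_const (ENNReal.ofReal_pos.2 ha)).exists
  rcases min_lt_iff.1 hn with hn | hn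
  · rw [← ENNReal.ofReal_toReal (measure_ne_top ν (A n)), ENNReal.ofReal_lt_ofReal_iff ha] at hn
    exact (hA1 n).not_gt hn
  · rw [← ENNReal.ofReal_toReal (measure_ne_top ν (A n)ᶜ), ENNReal.ofReal_lt_ofReal_iff ha] at hn
    change ν.real (A n)ᶜ < a at hn
    rw [probReal_compl_eq_one_sub (hAm n)] at hn
    linarith [hA2 n]

end Basic

end MarkovExpansion

namespace MarkovExpansion

/-! ### From Markov expansion to strong ergodicity -/

section FromMarkov

variable {Γ X : Type*} [Group Γ] [MeasurableSpace X] [MulAction Γ X]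

lemma tendsto_measure_sdiff_of_monotone (μ : Measure X) {Y : Set X} (hY : MeasurableSet Y)
    (hfin : μ Y ≠ ∞) {Z : ℕ → Set X} (hZ : ∀ n, MeasurableSet (Z n)) (hmono : Monotone Z)
    (h0 : μ (Y \ ⋃ n, Z n) = 0) : Tendsto (fun n => μ (Y \ Z n)) atTop (𝓝 0) := by
  have h := tendsto_measure_iInter_atTop (μ := μ) (s := fun n => Y \ Z n)
    (fun n => (hY.diff (hZ n)).nullMeasurableSet)
    (fun m n hmn => Set.sdiff_subset_sdiff_right (hmono hmn))
    ⟨0, ((measure_mono Set.sdiff_subset).trans_lt hfin.lt_top).ne⟩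
  rwa [← Set.sdiff_iUnion, h0] at h

variable [MeasurableConstSMul Γ X]

/-- `√r ≤ 1 + r`, and the integral of `r` is the measure of a translate that still lies in `Y`. -/
lemma MeasureClassPreserving.setLIntegral_sqrt_rnd_ne_top {ν : Measure X} [SigmaFinite ν]
    (hΓ : MeasureClassPreserving Γ ν) {Y : Set X} (hY : IsMeasureDomain ν Y) (s : Γ) :
    ∫⁻ x in Y ∩ (fun x => s • x) ⁻¹' Y, NNReal.sqrt (rnd ν s x) ∂ν ≠ ∞ := by
  have hE : MeasurableSet (Y ∩ (fun x => s • x) ⁻¹' Y) :=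
    hY.1.inter (measurable_const_smul s hY.1)
  have hle : ∀ x, (NNReal.sqrt (rnd ν s x) : ℝ≥0∞) ≤ 1 + rnd ν s x := by
    intro x
    have : NNReal.sqrt (rnd ν s x) ≤ 1 + rnd ν s x := by
      rw [NNReal.sqrt_le_iff_le_sq]
      nlinarith [sq_nonneg (rnd ν s x), (rnd_pos ν s x).le]
    exact_mod_cast this
  refine ((lintegral_mono hle).trans_lt ?_).ne
  rw [lintegral_add_left measurable_const, hΓ.setLIntegral_rnd s hE, setLIntegral_const, one_mul]
  refine ENNReal.add_lt_top.2 ⟨(measure_mono Set.inter_subset_left).trans_lt hY.2.2,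
    (measure_mono ?_).trans_lt hY.2.2⟩
  intro x hx
  simpa using hx.2

/-- The Cheeger inequality is applied to the half of `Z` (`C n` or its complement) with smaller
reversing measure. That measure dominates `ν`, because the term `s = 1` already gives `σ ≥ 1` almost
everywhere. -/
lemma IsDomainOfMarkovExpansionFor.tendsto_min {ν μ : Measure X} [SigmaFinite ν] [SigmaFinite μ]
    (hΓ : MeasureClassPreserving Γ ν) (hμ : ν ≪ μ) {S : Finset Γ} {Z : Set X}
    (hZ : IsDomainOfMarkovExpansionFor ν S Z) {C : ℕ → Set X} (hC : ∀ n, MeasurableSet (C n))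
    (hinv : ∀ γ : Γ, Tendsto (fun n => μ (C n ∆ (γ • C n))) atTop (𝓝 0)) :
    Tendsto (fun n => min (ν.restrict Z (C n)) (ν.restrict Z (C n)ᶜ)) atTop (𝓝 0) := by
  obtain ⟨hdom, h1, -, hch⟩ := hZ
  set κ := cheegerConstant (localKernel ν hdom.1 S) (reversingMeasure ν Z S) with hκ
  let ρ : Γ → Measure X := fun s =>
    (ν.restrict (Z ∩ (fun x => s • x) ⁻¹' Z)).withDensity fun x => NNReal.sqrt (rnd ν s x)
  have hρfin : ∀ s, IsFiniteMeasure (ρ s) := fun s =>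
    isFiniteMeasure_withDensity (hΓ.setLIntegral_sqrt_rnd_ne_top hdom s)
  have hρac : ∀ s, ρ s ≪ μ := fun s =>
    ((withDensity_absolutelyContinuous _ _).trans
      Measure.restrict_le_self.absolutelyContinuous).trans hμ
  have hlim : Tendsto (fun n => ∑ s ∈ S, ρ s (C n ∆ (s⁻¹ • C n))) atTop (𝓝 0) := by
    rw [← Finset.sum_const_zero (s := S)]
    exact tendsto_finsetSum _ fun s _ =>
      tendsto_measure_zero_of_absolutelyContinuous (hρac s) (hinv s⁻¹)
  have hνle : ∀ A, MeasurableSet A → A ⊆ Z →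
      ν A ≤ reversingMeasure ν Z S (Subtype.val ⁻¹' A) := by
    intro A hA hAZ
    rw [reversingMeasure_preimage ν hdom.1 S hA hAZ, ← setLIntegral_one]
    refine setLIntegral_mono_ae (measurable_sigma ν hdom.1 S).coe_nnreal_ennreal.aemeasurable ?_
    filter_upwards [hΓ.rnd_one_ae_eq] with x hx hxA
    have : (1 : ℝ≥0) ≤ sigma ν Z S x := by
      classical
      rw [sigma_eq]
      refine le_trans ?_ (Finset.single_le_sum (fun s _ => zero_le) h1)
      rw [one_smul, if_pos (hAZ hxA), hx, NNReal.sqrt_one]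
    exact_mod_cast this
  have key : ∀ n, ∀ A, MeasurableSet A → A ⊆ Z →
      (∀ s : Γ, A ∩ (fun x => s • x) ⁻¹' (Z \ A) ⊆ C n ∆ (s⁻¹ • C n)) →
      reversingMeasure ν Z S (Subtype.val ⁻¹' A) ≤ reversingMeasure ν Z S Set.univ / 2 →
      κ * ν A ≤ ∑ s ∈ S, ρ s (C n ∆ (s⁻¹ • C n)) := by
    intro n A hA hAZ hsub hhalf
    refine le_trans (mul_le_mul_right (hνle A hA hAZ) κ) ?_
    rcases eq_or_ne (reversingMeasure ν Z S (Subtype.val ⁻¹' A)) 0 with h0 | h0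
    · rw [h0, mul_zero]
      exact zero_le
    have hκle : κ ≤ boundarySize (localKernel ν hdom.1 S) (reversingMeasure ν Z S)
        (Subtype.val ⁻¹' A) / reversingMeasure ν Z S (Subtype.val ⁻¹' A) :=
      iInf₂_le (Subtype.val ⁻¹' A : Set Z)
        ⟨measurable_subtype_coe hA, pos_iff_ne_zero.2 h0, hhalf⟩
    refine (ENNReal.mul_le_of_le_div hκle).trans ?_
    rw [boundarySize_localKernel ν hdom.1 h1 hA hAZ]
    refine Finset.sum_le_sum fun s _ => ?_
    have hE : MeasurableSet (A ∩ (fun x => s • x) ⁻¹' (Z \ A)) :=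
      hA.inter (measurable_const_smul s (hdom.1.diff hA))
    refine le_trans ?_ (measure_mono (hsub s))
    have hEZ : A ∩ (fun x => s • x) ⁻¹' (Z \ A) ⊆ Z ∩ (fun x => s • x) ⁻¹' Z :=
      fun x hx => ⟨hAZ hx.1, hx.2.1⟩
    rw [withDensity_apply _ hE, Measure.restrict_restrict hE, Set.inter_eq_left.2 hEZ]
  have hle : ∀ n, κ * min (ν.restrict Z (C n)) (ν.restrict Z (C n)ᶜ) ≤
      ∑ s ∈ S, ρ s (C n ∆ (s⁻¹ • C n)) := by
    intro n
    have hsum := measure_add_measure_compl (μ := reversingMeasure ν Z S)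
      (s := Subtype.val ⁻¹' (C n)) (measurable_subtype_coe (hC n))
    have hpre : (Subtype.val ⁻¹' (C n) : Set Z) = Subtype.val ⁻¹' (C n ∩ Z) := by ext x; simp
    have hpre' : (Subtype.val ⁻¹' (C n) : Set Z)ᶜ = Subtype.val ⁻¹' ((C n)ᶜ ∩ Z) := by ext x; simp
    rw [Measure.restrict_apply (hC n), Measure.restrict_apply (hC n).compl]
    rcases le_total (reversingMeasure ν Z S (Subtype.val ⁻¹' (C n)))
      (reversingMeasure ν Z S (Subtype.val ⁻¹' (C n))ᶜ) with hcase | hcase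
    · refine le_trans (mul_le_mul_right (min_le_left _ _) κ) ?_
      refine key n _ ((hC n).inter hdom.1) Set.inter_subset_right (fun s x hx => ?_) ?_
      · refine Or.inl ⟨hx.1.1, fun hx' => hx.2.2 ⟨?_, hx.2.1⟩⟩
        rwa [← Set.preimage_smul] at hx'
      · rw [← hpre, ENNReal.le_div_iff_mul_le (by simp) (by simp), mul_two, ← hsum]
        gcongr
    · refine le_trans (mul_le_mul_right (min_le_right _ _) κ) ?_
      refine key n _ ((hC n).compl.inter hdom.1) Set.inter_subset_right (fun s x hx => ?_) ?_
      · refine Or.inr ⟨?_, hx.1.1⟩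
        rw [← Set.preimage_smul]
        by_contra hx'
        exact hx.2.2 ⟨hx', hx.2.1⟩
      · rw [← hpre', ENNReal.le_div_iff_mul_le (by simp) (by simp), mul_two, ← hsum]
        gcongr
  -- The constant `κ` is `∞` if no set is admissible, so it is truncated at `1` before dividing.
  have hlim' : Tendsto (fun n => (min κ 1)⁻¹ * ∑ s ∈ S, ρ s (C n ∆ (s⁻¹ • C n))) atTop (𝓝 0) := by
    have := ENNReal.Tendsto.const_mul (a := (min κ 1)⁻¹) hlim
      (Or.inr (ENNReal.inv_ne_top.2 (lt_min hch one_pos).ne'))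
    rwa [mul_zero] at this
  refine tendsto_of_tendsto_of_tendsto_of_le_of_le tendsto_const_nhds hlim'
    (fun n => zero_le) fun n => ?_
  rw [mul_comm, ← div_eq_mul_inv, ENNReal.le_div_iff_mul_le (Or.inl (lt_min hch one_pos).ne')
    (Or.inl ((min_le_right _ _).trans_lt ENNReal.one_lt_top).ne), mul_comm]
  exact (mul_le_mul_left (min_le_left _ _) _).trans (hle n)

lemma stronglyErgodic_of_exhaustions {ν : Measure X} [SigmaFinite ν] (hν : ν ≠ 0)
    (hΓ : MeasureClassPreserving Γ ν)
    (h : ∀ Y : Set X, IsMeasureDomain ν Y → ∃ Z : ℕ → Set X, IsExhaustion ν Y Z ∧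
      ∀ n, IsDomainOfMarkovExpansion Γ ν (Z n)) : StronglyErgodic Γ ν := by
  refine stronglyErgodic_of_tendsto_min hν fun C hC hinv => ?_
  set μ := ν.toFinite with hμdef
  have hμν : μ ≪ ν := toFinite_absolutelyContinuous ν
  have hνμ : ν ≪ μ := absolutelyContinuous_toFinite ν
  rw [ENNReal.tendsto_nhds_zero]
  intro ε hε
  have hε3 : 0 < ε / 3 := ENNReal.div_pos hε.ne' (by simp)
  obtain ⟨Y, hYm, hYfin, hYpos, hYε⟩ : ∃ Y : Set X, MeasurableSet Y ∧ ν Y < ∞ ∧ 0 < ν Y ∧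
      μ Yᶜ < ε / 3 := by
    have h1 := tendsto_measure_sdiff_of_monotone μ MeasurableSet.univ (measure_ne_top _ _)
      (measurableSet_spanningSets ν) (monotone_spanningSets ν) (by simp [iUnion_spanningSets])
    have h2 := tendsto_measure_iUnion_atTop (μ := ν) (monotone_spanningSets ν)
    rw [iUnion_spanningSets] at h2
    obtain ⟨n, hn1, hn2⟩ := ((h1.eventually_lt_const hε3).and
      (h2.eventually_const_lt (Measure.measure_univ_pos.2 hν))).exists
    exact ⟨_, measurableSet_spanningSets ν n, measure_spanningSets_lt_top ν n, hn2,
      by rwa [Set.compl_eq_univ_sdiff]⟩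
  obtain ⟨Z, ⟨hZm, hZmono, hZY, hZ0⟩, hZ⟩ := h Y ⟨hYm, hYpos, hYfin⟩
  obtain ⟨k, hk⟩ := ((tendsto_measure_sdiff_of_monotone μ hYm (measure_ne_top _ _) hZm hZmono
    (hμν hZ0)).eventually_lt_const hε3).exists
  obtain ⟨S, hS⟩ := hZ k
  have hlim := tendsto_min_measure_compl_of_absolutelyContinuous
    (hμν.restrict (Z k)) (hS.tendsto_min hΓ hνμ hC hinv)
  have hsplit : ∀ A, MeasurableSet A → μ A ≤ μ.restrict (Z k) A + (ε / 3 + ε / 3) := by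
    intro A hA
    rw [Measure.restrict_apply hA]
    have hincl : A ⊆ (A ∩ Z k) ∪ ((Y \ Z k) ∪ Yᶜ) := by
      intro x hx
      by_cases h1 : x ∈ Z k
      · exact Or.inl ⟨hx, h1⟩
      · by_cases h2 : x ∈ Y
        · exact Or.inr (Or.inl ⟨h2, h1⟩)
        · exact Or.inr (Or.inr h2)
    refine (measure_mono hincl).trans ((measure_union_le _ _).trans ?_)
    gcongr
    exact (measure_union_le _ _).trans (add_le_add hk.le hYε.le)
  filter_upwards [hlim.eventually_lt_const hε3] with n hn
  calc min (μ (C n)) (μ (C n)ᶜ)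
      ≤ min (μ.restrict (Z k) (C n)) (μ.restrict (Z k) (C n)ᶜ) + (ε / 3 + ε / 3) := by
        rw [← min_add_add_right]
        exact min_le_min (hsplit _ (hC n)) (hsplit _ (hC n).compl)
    _ ≤ ε / 3 + (ε / 3 + ε / 3) := by gcongr
    _ = ε := by rw [← add_assoc, ENNReal.add_thirds]

end FromMarkov

end MarkovExpansion

noncomputable section

namespace MarkovExpansion

/-! ### Crossings and linear isoperimetry -/

section Crossing

variable {Γ X : Type*} [Group Γ] [MeasurableSpace X] [MulAction Γ X]

/-- The total measure of the points of `A` that some `s ∈ S` moves to `B`, and vice versa. -/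
def crossing (ν : Measure X) (S : Finset Γ) (A B : Set X) : ℝ≥0∞ :=
  ∑ s ∈ S, (ν (A ∩ (fun x => s • x) ⁻¹' B) + ν (B ∩ (fun x => s • x) ⁻¹' A))

/-- Linear isoperimetric inequality on `W` for the graph structure given by `S`. -/
def IsIsoperimetric (ν : Measure X) (S : Finset Γ) (K : ℝ≥0∞) (W : Set X) : Prop :=
  ∀ A, MeasurableSet A → A ⊆ W →
    ν A ≤ K * crossing ν S A (W \ A) ∨ ν (W \ A) ≤ K * crossing ν S A (W \ A)

lemma crossing_comm (ν : Measure X) (S : Finset Γ) (A B : Set X) :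
    crossing ν S A B = crossing ν S B A :=
  Finset.sum_congr rfl fun _ _ => add_comm _ _

lemma crossing_mono (ν : Measure X) {S T : Finset Γ} (hST : S ⊆ T) {A A' B B' : Set X}
    (hA : A ⊆ A') (hB : B ⊆ B') : crossing ν S A B ≤ crossing ν T A' B' := by
  refine le_trans (Finset.sum_le_sum fun s _ => ?_)
    (Finset.sum_le_sum_of_subset_of_nonneg hST fun _ _ _ => zero_le)
  gcongr

lemma crossing_union_left_le (ν : Measure X) (S : Finset Γ) (A A' B : Set X) :
    crossing ν S (A ∪ A') B ≤ crossing ν S A B + crossing ν S A' B := by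
  rw [crossing, crossing, crossing, ← Finset.sum_add_distrib]
  refine Finset.sum_le_sum fun s _ => ?_
  rw [Set.preimage_union, Set.union_inter_distrib_right, Set.inter_union_distrib_left,
    add_add_add_comm]
  exact add_le_add (measure_union_le _ _) (measure_union_le _ _)

lemma crossing_iUnion_le (ν : Measure X) (S : Finset Γ) {A : ℕ → Set X} (hA : Monotone A)
    (B : Set X) {c : ℝ≥0∞} (h : ∀ n, crossing ν S (A n) B ≤ c) :
    crossing ν S (⋃ n, A n) B ≤ c := by
  have hlim : Tendsto (fun n => crossing ν S (A n) B) atTop (𝓝 (crossing ν S (⋃ n, A n) B)) := by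
    refine tendsto_finsetSum _ fun s _ => Tendsto.add ?_ ?_
    · rw [Set.iUnion_inter]
      exact tendsto_measure_iUnion_atTop fun m n hmn => Set.inter_subset_inter_left _ (hA hmn)
    · rw [Set.preimage_iUnion, Set.inter_iUnion]
      exact tendsto_measure_iUnion_atTop fun m n hmn =>
        Set.inter_subset_inter_right _ (Set.preimage_mono (hA hmn))
  exact le_of_tendsto' hlim h

/-- If the same side of the cut is small in both pieces, the bounds add. If opposite sides are
small, together they cover `W₁ ∩ W₂`, so the crossing is at least a fixed multiple of the total
measure; the ratio `q` accounts for this. -/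
lemma IsIsoperimetric.union {ν : Measure X} {S₁ S₂ T : Finset Γ} {K₁ K₂ : ℝ≥0∞} {W₁ W₂ : Set X}
    (h₁ : IsIsoperimetric ν S₁ K₁ W₁) (h₂ : IsIsoperimetric ν S₂ K₂ W₂) (hT₁ : S₁ ⊆ T)
    (hT₂ : S₂ ⊆ T) (hW₁ : MeasurableSet W₁) (hW₂ : MeasurableSet W₂) (hK₁ : K₁ ≠ ∞) (hK₂ : K₂ ≠ ∞)
    (hfin₁ : ν W₁ ≠ ∞) (hfin₂ : ν W₂ ≠ ∞) (hpos : ν (W₁ ∩ W₂) ≠ 0) :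
    ∃ K ≠ ∞, IsIsoperimetric ν T K (W₁ ∪ W₂) := by
  have hfin : ν (W₁ ∪ W₂) ≠ ∞ := measure_union_ne_top hfin₁ hfin₂
  have hfin' : ν (W₁ ∩ W₂) ≠ ∞ := ((measure_mono Set.inter_subset_left).trans_lt hfin₁.lt_top).ne
  set q := ν (W₁ ∪ W₂) / ν (W₁ ∩ W₂) with hq
  have hqtop : q ≠ ∞ := ENNReal.div_ne_top hfin hpos
  have hq1 : 1 ≤ q := by
    rw [hq, ENNReal.le_div_iff_mul_le (Or.inl hpos) (Or.inl hfin'), one_mul]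
    exact measure_mono (Set.inter_subset_left.trans Set.subset_union_left)
  refine ⟨q * (K₁ + K₂), ENNReal.mul_ne_top hqtop (ENNReal.add_ne_top.2 ⟨hK₁, hK₂⟩), ?_⟩
  intro A hA hAW
  set B := (W₁ ∪ W₂) \ A with hB
  set t := crossing ν T A B with ht
  have hcross : ∀ {S : Finset Γ} {W : Set X}, S ⊆ T → W ⊆ W₁ ∪ W₂ →
      crossing ν S (A ∩ W) (W \ (A ∩ W)) ≤ t := by
    intro S W hS hW
    refine crossing_mono ν hS Set.inter_subset_left fun x hx =>
      ⟨hW hx.1, fun hxA => hx.2 ⟨hxA, hx.1⟩⟩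
  have c₁ := h₁ (A ∩ W₁) (hA.inter hW₁) Set.inter_subset_right
  have c₂ := h₂ (A ∩ W₂) (hA.inter hW₂) Set.inter_subset_right
  have d₁ := mul_le_mul_right (hcross hT₁ Set.subset_union_left) K₁
  have d₂ := mul_le_mul_right (hcross hT₂ Set.subset_union_right) K₂
  have bound : (K₁ + K₂) * t ≤ q * (K₁ + K₂) * t := by
    rw [mul_assoc]
    exact le_mul_of_one_le_left zero_le hq1
  have mixed : ν (W₁ ∩ W₂) ≤ (K₁ + K₂) * t → ν A ≤ q * (K₁ + K₂) * t := by
    intro h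
    calc ν A ≤ ν (W₁ ∪ W₂) := measure_mono hAW
      _ = q * ν (W₁ ∩ W₂) := (ENNReal.div_mul_cancel hpos hfin').symm
      _ ≤ q * ((K₁ + K₂) * t) := by gcongr
      _ = _ := (mul_assoc _ _ _).symm
  rcases c₁ with c₁ | c₁ <;> rcases c₂ with c₂ | c₂
  · left
    refine le_trans ?_ bound
    have hincl : A ⊆ (A ∩ W₁) ∪ (A ∩ W₂) := by
      rw [← Set.inter_union_distrib_left]
      exact Set.subset_inter subset_rfl hAW
    rw [add_mul]
    exact (measure_mono hincl).trans ((measure_union_le _ _).trans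
      (add_le_add (c₁.trans d₁) (c₂.trans d₂)))
  · left
    refine mixed ?_
    have hincl : W₁ ∩ W₂ ⊆ (A ∩ W₁) ∪ (W₂ \ (A ∩ W₂)) := by
      intro x hx
      by_cases hxA : x ∈ A
      · exact Or.inl ⟨hxA, hx.1⟩
      · exact Or.inr ⟨hx.2, fun h => hxA h.1⟩
    rw [add_mul]
    exact (measure_mono hincl).trans ((measure_union_le _ _).trans
      (add_le_add (c₁.trans d₁) (c₂.trans d₂)))
  · left
    refine mixed ?_
    have hincl : W₁ ∩ W₂ ⊆ (W₁ \ (A ∩ W₁)) ∪ (A ∩ W₂) := by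
      intro x hx
      by_cases hxA : x ∈ A
      · exact Or.inr ⟨hxA, hx.2⟩
      · exact Or.inl ⟨hx.1, fun h => hxA h.1⟩
    rw [add_mul]
    exact (measure_mono hincl).trans ((measure_union_le _ _).trans
      (add_le_add (c₁.trans d₁) (c₂.trans d₂)))
  · right
    refine le_trans ?_ bound
    have hincl : B ⊆ (W₁ \ (A ∩ W₁)) ∪ (W₂ \ (A ∩ W₂)) := by
      rintro x ⟨hx | hx, hxA⟩
      · exact Or.inl ⟨hx, fun h => hxA h.1⟩
      · exact Or.inr ⟨hx, fun h => hxA h.1⟩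
    rw [add_mul]
    exact (measure_mono hincl).trans ((measure_union_le _ _).trans
      (add_le_add (c₁.trans d₁) (c₂.trans d₂)))

/-! ### Removing a maximal set of small boundary -/

lemma exists_maximal_measure_of_iUnion_mem (ν : Measure X) {F : Set (Set X)} (hne : F.Nonempty)
    {M : ℝ≥0∞} (hM : M ≠ ∞) (hFM : ∀ E ∈ F, ν E ≤ M)
    (hF : ∀ E : ℕ → Set X, Monotone E → (∀ n, E n ∈ F) → ⋃ n, E n ∈ F) :
    ∃ E ∈ F, ∀ E' ∈ F, E ⊆ E' → ν E' ≤ ν E := by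
  -- Each greedy extension comes within `1/(n+1)` of the supremum over all members containing the
  -- current set; the union of the chain is then maximal in measure.
  have step : ∀ (n : ℕ) (E : F), ∃ E' : F, E.1 ⊆ E'.1 ∧
      ∀ D ∈ F, E.1 ⊆ D → ν D ≤ ν E'.1 + ((n : ℝ≥0∞) + 1)⁻¹ := by
    intro n E
    set σ := ⨆ D ∈ {D | D ∈ F ∧ E.1 ⊆ D}, ν D with hσ
    have hσM : σ ≠ ∞ := ((iSup₂_le fun D hD => hFM D hD.1).trans_lt hM.lt_top).ne
    have hle : ∀ D ∈ F, E.1 ⊆ D → ν D ≤ σ := fun D hD hED =>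
      le_iSup₂_of_le D ⟨hD, hED⟩ le_rfl
    have hδ : ((n : ℝ≥0∞) + 1)⁻¹ ≠ 0 := ENNReal.inv_ne_zero.2 (by finiteness)
    rcases eq_or_ne σ 0 with h0 | h0
    · exact ⟨E, subset_rfl, fun D hD hED => (hle D hD hED).trans (h0 ▸ zero_le)⟩
    · obtain ⟨D, hD, hlt⟩ := lt_biSup_iff.1 (ENNReal.sub_lt_self hσM h0 hδ)
      exact ⟨⟨D, hD.1⟩, hD.2, fun D' hD' hED' =>
        (hle D' hD' hED').trans (tsub_le_iff_right.1 hlt.le)⟩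
  choose next hsub hnext using step
  obtain ⟨E₀, hE₀⟩ := hne
  let E : ℕ → F := fun n => Nat.rec ⟨E₀, hE₀⟩ (fun k D => next k D) n
  have hmono : Monotone fun n => (E n).1 := monotone_nat_of_le_succ fun n => hsub n (E n)
  refine ⟨⋃ n, (E n).1, hF _ hmono fun n => (E n).2, fun D hD hED => ?_⟩
  have hlim : Tendsto (fun n : ℕ => ν (⋃ n, (E n).1) + ((n : ℝ≥0∞) + 1)⁻¹) atTop
      (𝓝 (ν (⋃ n, (E n).1) + 0)) := by
    refine Tendsto.const_add _ ?_
    have := (tendsto_add_atTop_iff_nat 1).2 ENNReal.tendsto_inv_nat_nhds_zero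
    simpa using this
  rw [add_zero] at hlim
  refine ge_of_tendsto' hlim fun n => ?_
  refine (hnext n (E n) D hD ((Set.subset_iUnion (fun n => (E n).1) n).trans hED)).trans ?_
  gcongr
  exact Set.subset_iUnion (fun n => (E n).1) (n + 1)

lemma exists_isIsoperimetric_sdiff {ν : Measure X} {Y : Set X} (hY : IsMeasureDomain ν Y)
    {S : Finset Γ} {a c : ℝ≥0∞} (ha : 3 * a ≤ ν Y) (hc : c ≠ 0)
    (h : ∀ A, MeasurableSet A → A ⊆ Y → a ≤ ν A → a ≤ ν (Y \ A) → c ≤ crossing ν S A (Y \ A)) :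
    ∃ E, MeasurableSet E ∧ E ⊆ Y ∧ ν E < a ∧ ∃ K ≠ ∞, IsIsoperimetric ν S K (Y \ E) := by
  obtain ⟨hYm, hYpos, hYfin⟩ := hY
  obtain ⟨d, hd0, hdtop, hdc⟩ : ∃ d : ℝ≥0∞, d ≠ 0 ∧ d ≠ ∞ ∧ d * ν Y < c := by
    obtain ⟨d, hd0, hd⟩ := ENNReal.exists_nnreal_pos_mul_lt hYfin.ne hc
    exact ⟨d, by exact_mod_cast hd0.ne', ENNReal.coe_ne_top, hd⟩
  -- Since `d * ν Y < c`, a member of measure at least `a` would violate the crossing bound `h`.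
  -- Thus every member has measure below `a`.
  let F : Set (Set X) := {E | MeasurableSet E ∧ E ⊆ Y ∧ a ≤ ν (Y \ E) ∧
    crossing ν S E (Y \ E) ≤ d * ν E}
  have hsmall : ∀ E ∈ F, ν E < a := by
    rintro E ⟨hE, hEY, hEa, hEc⟩
    by_contra! hcon
    exact (((h E hE hEY hcon hEa).trans hEc).trans (mul_le_mul_right (measure_mono hEY) d)).not_gt
      hdc
  have haY : a ≤ ν Y := le_trans (le_mul_of_one_le_left zero_le (by norm_num)) ha
  have hFne : F.Nonempty := ⟨∅, MeasurableSet.empty, Set.empty_subset _, by simpa using haY,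
    by simp [crossing]⟩
  have hFU : ∀ E : ℕ → Set X, Monotone E → (∀ n, E n ∈ F) → ⋃ n, E n ∈ F := by
    intro E hmono hE
    refine ⟨MeasurableSet.iUnion fun n => (hE n).1, Set.iUnion_subset fun n => (hE n).2.1, ?_, ?_⟩
    · have hlim := tendsto_measure_iInter_atTop (μ := ν) (s := fun n => Y \ E n)
        (fun n => (hYm.diff (hE n).1).nullMeasurableSet)
        (fun m n hmn => Set.sdiff_subset_sdiff_right (hmono hmn))
        ⟨0, ((measure_mono Set.sdiff_subset).trans_lt hYfin).ne⟩
      rw [← Set.sdiff_iUnion] at hlim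
      exact ge_of_tendsto' hlim fun n => (hE n).2.2.1
    · refine crossing_iUnion_le ν S hmono _ fun n => ?_
      refine (crossing_mono ν subset_rfl subset_rfl
        (Set.sdiff_subset_sdiff_right (Set.subset_iUnion E n))).trans ((hE n).2.2.2.trans ?_)
      gcongr
      exact Set.subset_iUnion E n
  obtain ⟨E, hEF, hmax⟩ := exists_maximal_measure_of_iUnion_mem ν hFne hYfin.ne
    (fun E hE => measure_mono hE.2.1) hFU
  have hEa := hsmall E hEF
  obtain ⟨hE, hEY, -, hEc⟩ := hEF
  have hEfin : ν E ≠ ∞ := hEa.ne_top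
  refine ⟨E, hE, hEY, hEa, d⁻¹, ENNReal.inv_ne_top.2 hd0, ?_⟩
  -- A violating `A` could be added to `E` within `F`, so maximality forces `ν A = 0`, which
  -- contradicts the strict violation.
  have key : ∀ A, MeasurableSet A → A ⊆ Y \ E → a ≤ ν ((Y \ E) \ A) →
      ν A ≤ d⁻¹ * crossing ν S A ((Y \ E) \ A) := by
    intro A hA hAZ haA
    by_contra! hlt
    have hlt' : crossing ν S A ((Y \ E) \ A) < d * ν A := by
      rw [mul_comm, ← div_eq_mul_inv] at hlt
      rw [mul_comm]
      exact (ENNReal.div_lt_iff (Or.inl hd0) (Or.inl hdtop)).1 hlt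
    have hdisj : Disjoint E A := Set.disjoint_left.2 fun x hxE hxA => (hAZ hxA).2 hxE
    have hmem : E ∪ A ∈ F := by
      refine ⟨hE.union hA, Set.union_subset hEY (hAZ.trans Set.sdiff_subset), ?_, ?_⟩
      · rwa [← Set.sdiff_sdiff]
      · rw [measure_union hdisj hA, mul_add]
        refine (crossing_union_left_le ν S _ _ _).trans (add_le_add ?_ ?_)
        · exact (crossing_mono ν subset_rfl subset_rfl
            (Set.sdiff_subset_sdiff_right Set.subset_union_left)).trans hEc
        · rw [← Set.sdiff_sdiff]
          exact hlt'.le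
    have h1 := hmax _ hmem Set.subset_union_left
    rw [measure_union hdisj hA] at h1
    have h2 : ν A = 0 := by
      have := ENNReal.le_of_add_le_add_left hEfin (h1.trans_eq (add_zero _).symm)
      exact le_antisymm this zero_le
    rw [h2] at hlt'
    simp at hlt'
  intro A hA hAZ
  rcases le_or_gt a (ν ((Y \ E) \ A)) with hcase | hcase
  · exact Or.inl (key A hA hAZ hcase)
  · right
    have hcompl : (Y \ E) \ ((Y \ E) \ A) = A := by
      rw [Set.sdiff_sdiff_right_self, Set.inter_eq_right.2 hAZ]
    have := key ((Y \ E) \ A) ((hYm.diff hE).diff hA) Set.sdiff_subset ?_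
    · rwa [hcompl, crossing_comm] at this
    · rw [hcompl]
      -- Otherwise `E`, `A` and the rest all have measure below `a`, against `3 * a ≤ ν Y`.
      by_contra! hAa
      have hcover : Y ⊆ E ∪ (A ∪ ((Y \ E) \ A)) := by
        intro x hx
        by_cases h1 : x ∈ E
        · exact Or.inl h1
        · by_cases h2 : x ∈ A
          · exact Or.inr (Or.inl h2)
          · exact Or.inr (Or.inr ⟨⟨hx, h1⟩, h2⟩)
      have hlt : ν Y < a + (a + a) :=
        (measure_mono hcover).trans_lt ((measure_union_le _ _).trans_lt
          (ENNReal.add_lt_add hEa ((measure_union_le _ _).trans_lt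
            (ENNReal.add_lt_add hAa hcase))))
      have h3 : a + (a + a) = 3 * a := by ring
      exact (ha.trans_lt (h3 ▸ hlt)).false

end Crossing

end MarkovExpansion

end

namespace MarkovExpansion

/-! ### Localising strong ergodicity to a domain -/

section Localisation

variable {Γ X : Type*} [Group Γ] [MeasurableSpace X] [MulAction Γ X] [MeasurableConstSMul Γ X]

/-- The orbit of a domain under a strongly ergodic action is conull. -/
lemma StronglyErgodic.measure_compl_iUnion_preimage [Countable Γ] {ν : Measure X} [SigmaFinite ν]
    (h : StronglyErgodic Γ ν) {Y : Set X} (hY : IsMeasureDomain ν Y) :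
    ν (⋃ γ : Γ, (fun x => γ • x) ⁻¹' Y)ᶜ = 0 := by
  set U := ⋃ γ : Γ, (fun x => γ • x) ⁻¹' Y with hU
  have hUm : MeasurableSet U := MeasurableSet.iUnion fun γ => measurable_const_smul γ hY.1
  have hinv : ∀ γ : Γ, γ • U = U := by
    intro γ
    ext x
    simp only [hU, Set.mem_smul_set_iff_inv_smul_mem, Set.mem_iUnion, Set.mem_preimage]
    constructor
    · rintro ⟨g, hg⟩
      exact ⟨g * γ⁻¹, by rwa [mul_smul]⟩
    · rintro ⟨g, hg⟩
      exact ⟨g * γ, by rwa [mul_smul, smul_inv_smul]⟩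
  -- The constant sequence `U` is invariant, so `U` is null or conull; it contains `Y`.
  have hlim := h.tendsto_min (ρ := ν) (ρ' := ν.toFinite) Measure.AbsolutelyContinuous.rfl
    (toFinite_absolutelyContinuous ν) (C := fun _ => U) (fun _ => hUm) (fun γ => by simp [hinv γ])
  have h0 := tendsto_nhds_unique hlim tendsto_const_nhds
  rcases min_eq_iff.1 h0.symm with ⟨h0, -⟩ | ⟨h0, -⟩
  · refine absurd (measure_mono_null ?_ (absolutelyContinuous_toFinite ν h0)) hY.2.1.ne'
    exact fun x hx => Set.mem_iUnion.2 ⟨1, by simpa using hx⟩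
  · exact absolutelyContinuous_toFinite ν h0

/-- A strongly ergodic action expands asymptotically inside every domain. -/
lemma StronglyErgodic.exists_le_crossing [Countable Γ] {ν : Measure X} [SigmaFinite ν]
    (hΓ : MeasureClassPreserving Γ ν) (h : StronglyErgodic Γ ν) {Y : Set X}
    (hY : IsMeasureDomain ν Y) {a : ℝ≥0∞} (ha : a ≠ 0) :
    ∃ (S : Finset Γ) (c : ℝ≥0∞), c ≠ 0 ∧ ∀ A, MeasurableSet A → A ⊆ Y → a ≤ ν A →
      a ≤ ν (Y \ A) → c ≤ crossing ν S A (Y \ A) := by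
  classical
  by_contra! hcon
  -- Starting at `1` makes points of `Y` hit `Y` at time `0`, so the extension `C n` below agrees
  -- with `A n` on `Y`.
  obtain ⟨e, he, he0⟩ : ∃ e : ℕ → Γ, Function.Surjective e ∧ e 0 = 1 := by
    obtain ⟨e, he⟩ := exists_surjective_nat Γ
    exact ⟨fun k => Nat.casesOn k 1 e, fun γ => (he γ).elim fun k hk => ⟨k + 1, hk⟩, rfl⟩
  choose A hAm hAY hA1 hA2 hA3 using fun n : ℕ =>
    hcon ((Finset.range n).image e) ((n : ℝ≥0∞) + 1)⁻¹ (ENNReal.inv_ne_zero.2 (by finiteness))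
  let D : Γ → ℕ → Set X := fun g n =>
    (A n ∩ (fun x => g • x) ⁻¹' (Y \ A n)) ∪ ((Y \ A n) ∩ (fun x => g • x) ⁻¹' A n)
  have hDm : ∀ g n, MeasurableSet (D g n) := fun g n =>
    ((hAm n).inter (measurable_const_smul g (hY.1.diff (hAm n)))).union
      ((hY.1.diff (hAm n)).inter (measurable_const_smul g (hAm n)))
  have hD : ∀ g, Tendsto (fun n => ν (D g n)) atTop (𝓝 0) := by
    intro g
    obtain ⟨k, rfl⟩ := he g
    have hlim : Tendsto (fun n : ℕ => ((n : ℝ≥0∞) + 1)⁻¹) atTop (𝓝 0) := by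
      simpa using (tendsto_add_atTop_iff_nat 1).2 ENNReal.tendsto_inv_nat_nhds_zero
    refine tendsto_of_tendsto_of_tendsto_of_le_of_le' tendsto_const_nhds hlim
      (Eventually.of_forall fun n => zero_le) ?_
    filter_upwards [eventually_gt_atTop k] with n hn
    refine (measure_union_le _ _).trans (le_trans ?_ (hA3 n).le)
    exact Finset.single_le_sum (f := fun s : Γ => ν (A n ∩ (fun x => s • x) ⁻¹' (Y \ A n)) +
      ν ((Y \ A n) ∩ (fun x => s • x) ⁻¹' A n)) (fun _ _ => zero_le)
      (Finset.mem_image_of_mem e (Finset.mem_range.2 hn))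
  set μ := ν.toFinite with hμdef
  have hμν : μ ≪ ν := toFinite_absolutelyContinuous ν
  have hνμ : ν ≪ μ := absolutelyContinuous_toFinite ν
  have hΓμ : MeasureClassPreserving Γ μ := fun γ B hB => hμν (hΓ γ B (hνμ hB))
  -- Points that have not hit `Y` before time `N`. Continuity from above needs the finite measure
  -- `μ`.
  let T : ℕ → Set X := fun N => ⋂ k ∈ Finset.range N, (fun x => e k • x) ⁻¹' Yᶜ
  have hTm : ∀ N, MeasurableSet (T N) := fun N =>
    Finset.measurableSet_biInter _ fun k _ => measurable_const_smul (e k) hY.1.compl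
  have hT : Tendsto (fun N => μ (T N)) atTop (𝓝 0) := by
    have hlim := tendsto_measure_iInter_atTop (μ := μ) (fun N => (hTm N).nullMeasurableSet)
      (fun M N hMN => Set.biInter_subset_biInter_left fun k hk =>
        Finset.range_mono hMN hk) ⟨0, measure_ne_top μ _⟩
    have h0 : μ (⋂ N, T N) = 0 := by
      refine measure_mono_null ?_ (hμν (h.measure_compl_iUnion_preimage hY))
      intro x hx
      simp only [Set.mem_compl_iff, Set.mem_iUnion, not_exists]
      intro γ hγ
      obtain ⟨k, rfl⟩ := he γ
      exact Set.mem_iInter₂.1 (Set.mem_iInter.1 hx (k + 1)) k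
        (Finset.mem_range.2 k.lt_succ_self) hγ
    rwa [h0] at hlim
  -- A point belongs to `C n` when its first hit of `Y` along the enumeration lands in `A n`.
  let C : ℕ → Set X := fun n => ⋃ k, (fun x => e k • x) ⁻¹' A n ∩ T k
  have hCm : ∀ n, MeasurableSet (C n) := fun n =>
    MeasurableSet.iUnion fun k => (measurable_const_smul (e k) (hAm n)).inter (hTm k)
  have hfirst : ∀ {N x}, x ∉ T N → ∃ k < N, e k • x ∈ Y ∧ x ∈ T k := by
    intro N x hx
    have hex : ∃ k, k < N ∧ e k • x ∈ Y := by
      by_contra! hno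
      exact hx (Set.mem_iInter₂.2 fun k hk => hno k (Finset.mem_range.1 hk))
    refine ⟨Nat.find hex, (Nat.find_spec hex).1, (Nat.find_spec hex).2, ?_⟩
    refine Set.mem_iInter₂.2 fun j hj hjY => Nat.find_min hex (Finset.mem_range.1 hj)
      ⟨(Finset.mem_range.1 hj).trans (Nat.find_spec hex).1, hjY⟩
  have hmemC : ∀ {n k x}, e k • x ∈ Y → x ∈ T k → (x ∈ C n ↔ e k • x ∈ A n) := by
    intro n k x hkY hkT
    refine ⟨fun hx => ?_, fun hx => Set.mem_iUnion.2 ⟨k, hx, hkT⟩⟩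
    obtain ⟨l, hlA, hlT⟩ := Set.mem_iUnion.1 hx
    rcases lt_trichotomy k l with hkl | rfl | hkl
    · exact absurd hkY (Set.mem_iInter₂.1 hlT k (Finset.mem_range.2 hkl))
    · exact hlA
    · exact absurd (hAY n hlA) (Set.mem_iInter₂.1 hkT l (Finset.mem_range.2 hkl))
  -- If `x` and `γ⁻¹ • x` first hit `Y` at times `k, l < N`, then `e l * γ⁻¹ * (e k)⁻¹` carries one
  -- hitting point to the other. Disagreement about `C n` is therefore a crossing of the cut by one
  -- of finitely many group elements.
  have hsub : ∀ (γ : Γ) (N n : ℕ), C n ∆ (γ • C n) ⊆ (⋃ p ∈ Finset.range N ×ˢ Finset.range N,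
      (fun x => e p.1 • x) ⁻¹' D (e p.2 * γ⁻¹ * (e p.1)⁻¹) n) ∪ (T N ∪ γ • T N) := by
    intro γ N n x hx
    by_cases hx1 : x ∈ T N
    · exact Or.inr (Or.inl hx1)
    by_cases hx2 : γ⁻¹ • x ∈ T N
    · exact Or.inr (Or.inr (Set.mem_smul_set_iff_inv_smul_mem.2 hx2))
    left
    obtain ⟨k, hk, hkY, hkT⟩ := hfirst hx1
    obtain ⟨l, hl, hlY, hlT⟩ := hfirst hx2
    refine Set.mem_iUnion₂.2 ⟨(k, l), Finset.mk_mem_product (Finset.mem_range.2 hk)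
      (Finset.mem_range.2 hl), ?_⟩
    have hg : (e l * γ⁻¹ * (e k)⁻¹) • e k • x = e l • γ⁻¹ • x := by
      simp [mul_smul]
    rcases hx with ⟨h1, h2⟩ | ⟨h1, h2⟩ <;>
      rw [Set.mem_smul_set_iff_inv_smul_mem, hmemC hlY hlT] at * <;>
      rw [hmemC hkY hkT] at *
    · refine Or.inl ⟨h1, ?_⟩
      rw [Set.mem_preimage, hg]
      exact ⟨hlY, h2⟩
    · refine Or.inr ⟨⟨hkY, h2⟩, ?_⟩
      rw [Set.mem_preimage, hg]
      exact h1
  have hinv : ∀ γ : Γ, Tendsto (fun n => μ (C n ∆ (γ • C n))) atTop (𝓝 0) := by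
    intro γ
    rw [ENNReal.tendsto_nhds_zero]
    intro ε hε
    have hε2 : 0 < ε / 2 := ENNReal.half_pos hε.ne'
    have hT2 := hT.add (hΓμ.tendsto_measure_smul Measure.AbsolutelyContinuous.rfl γ hTm hT)
    rw [add_zero] at hT2
    obtain ⟨N, hN⟩ := (hT2.eventually_lt_const hε2).exists
    have hsum : Tendsto (fun n => ∑ p ∈ Finset.range N ×ˢ Finset.range N,
        μ ((fun x => e p.1 • x) ⁻¹' D (e p.2 * γ⁻¹ * (e p.1)⁻¹) n)) atTop (𝓝 0) := by
      rw [← Finset.sum_const_zero (s := Finset.range N ×ˢ Finset.range N)]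
      refine tendsto_finsetSum _ fun p _ => ?_
      refine (tendsto_measure_zero_of_absolutelyContinuous
        (hΓ.map_absolutelyContinuous hμν (e p.1)) (hD (e p.2 * γ⁻¹ * (e p.1)⁻¹))).congr fun n => ?_
      rw [Measure.map_apply (measurable_const_smul (e p.1)) (hDm _ n)]
    filter_upwards [hsum.eventually_lt_const hε2] with n hn
    refine (measure_mono (hsub γ N n)).trans ((measure_union_le _ _).trans ?_)
    rw [← ENNReal.add_halves ε]
    exact add_le_add ((measure_biUnion_finset_le _ _).trans hn.le)
      ((measure_union_le _ _).trans hN.le)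
  have : IsFiniteMeasure (ν.restrict Y) := ⟨by simpa using hY.2.2⟩
  have hlim := h.tendsto_min (ρ := μ) (ρ' := ν.restrict Y) hνμ
    Measure.restrict_le_self.absolutelyContinuous hCm hinv
  obtain ⟨n, hn⟩ := (hlim.eventually_lt_const (pos_iff_ne_zero.2 ha)).exists
  have hCY : ∀ {x}, x ∈ Y → (x ∈ C n ↔ x ∈ A n) := by
    intro x hx
    have := hmemC (n := n) (k := 0) (x := x) (by simpa [he0] using hx) (by simp [T])
    simpa [he0] using this
  rw [Measure.restrict_apply (hCm n), Measure.restrict_apply (hCm n).compl] at hn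
  rcases min_lt_iff.1 hn with hn | hn
  · refine ((hA1 n).trans (measure_mono ?_)).not_gt hn
    exact fun x hx => ⟨(hCY (hAY n hx)).2 hx, hAY n hx⟩
  · refine ((hA2 n).trans (measure_mono ?_)).not_gt hn
    exact fun x hx => ⟨fun hxC => hx.2 ((hCY hx.1).1 hxC), hx.1⟩

end Localisation

end MarkovExpansion

namespace MarkovExpansion

/-! ### Bounded derivatives, comparison and the exhaustion -/

section Exhaustion

variable {Γ X : Type*} [Group Γ] [MeasurableSpace X] [MulAction Γ X]

/-- A domain is exhausted by sets on which every Radon–Nikodym derivative is bounded above and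
below, with prescribed bounds on the measures of the complements. -/
lemma exists_exhaustion_rnd_bounded [Countable Γ] (ν : Measure X) {Y : Set X}
    (hY : IsMeasureDomain ν Y) {η : ℕ → ℝ≥0∞} (hη : ∀ k, η k ≠ 0) :
    ∃ (V : ℕ → Set X) (Θ : ℕ → Γ → ℝ≥0), (∀ k, MeasurableSet (V k)) ∧ Monotone V ∧
      (∀ k, V k ⊆ Y) ∧ (∀ k, ν (Y \ V k) ≤ η k) ∧
      ∀ k, ∀ y ∈ V k, ∀ s, rnd ν s y ≤ Θ k s ∧ (rnd ν s y)⁻¹ ≤ Θ k s := by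
  have hinv : ∀ s : Γ, Measurable fun y => (rnd ν s y)⁻¹ := fun s => (measurable_rnd ν s).inv
  have hone : ∀ (s : Γ) (δ : ℝ≥0∞), 0 < δ → ∃ N : ℕ,
      ν (Y \ {y | y ∈ Y ∧ rnd ν s y ≤ N ∧ (rnd ν s y)⁻¹ ≤ N}) < δ := by
    intro s δ hδ
    refine ((tendsto_measure_sdiff_of_monotone ν hY.1 hY.2.2.ne (fun N => ?_) ?_
      ?_).eventually_lt_const hδ).exists
    · exact hY.1.inter ((measurable_rnd ν s measurableSet_Iic).inter
        (hinv s measurableSet_Iic))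
    · intro M N hMN y hy
      have : (M : ℝ≥0) ≤ N := by exact_mod_cast hMN
      exact ⟨hy.1, hy.2.1.trans this, hy.2.2.trans this⟩
    · convert measure_empty (μ := ν)
      refine Set.sdiff_eq_empty.2 fun y hy => Set.mem_iUnion.2 ?_
      obtain ⟨N, hN⟩ := exists_nat_ge (max (rnd ν s y) (rnd ν s y)⁻¹)
      exact ⟨N, hy, (le_max_left _ _).trans hN, (le_max_right _ _).trans hN⟩
  choose δ hδ0 hδ using fun k => ENNReal.exists_pos_sum_of_countable' (hη k) Γ
  choose N hN using fun (k : ℕ) (s : Γ) => hone s (δ k s) (hδ0 k s)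
  -- Partial sums make the bounds increase with `k`, hence the sets `V k` nested.
  let Θ : ℕ → Γ → ℝ≥0 := fun k s => ∑ j ∈ Finset.range (k + 1), (N j s : ℝ≥0)
  have hΘmono : ∀ s, Monotone fun k => Θ k s := fun s k l hkl =>
    Finset.sum_le_sum_of_subset_of_nonneg
      (Finset.range_mono (Nat.succ_le_succ hkl)) fun _ _ _ => zero_le
  have hNΘ : ∀ k s, (N k s : ℝ≥0) ≤ Θ k s := fun k s =>
    Finset.single_le_sum (f := fun j => (N j s : ℝ≥0)) (fun _ _ => zero_le)
      (Finset.self_mem_range_succ k)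
  refine ⟨fun k => Y ∩ ⋂ s, {y | rnd ν s y ≤ Θ k s ∧ (rnd ν s y)⁻¹ ≤ Θ k s}, Θ, fun k => ?_,
    fun k l hkl y hy => ⟨hy.1, Set.mem_iInter.2 fun s => ?_⟩, fun k => Set.inter_subset_left,
    fun k => ?_, fun k y hy s => Set.mem_iInter.1 hy.2 s⟩
  · exact hY.1.inter (MeasurableSet.iInter fun s =>
      (measurable_rnd ν s measurableSet_Iic).inter
        (hinv s measurableSet_Iic))
  · have := Set.mem_iInter.1 hy.2 s
    exact ⟨this.1.trans (hΘmono s hkl), this.2.trans (hΘmono s hkl)⟩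
  · have hincl : Y \ (Y ∩ ⋂ s, {y | rnd ν s y ≤ Θ k s ∧ (rnd ν s y)⁻¹ ≤ Θ k s}) ⊆
        ⋃ s, Y \ {y | y ∈ Y ∧ rnd ν s y ≤ N k s ∧ (rnd ν s y)⁻¹ ≤ N k s} := by
      intro y hy
      by_contra hno
      refine hy.2 ⟨hy.1, Set.mem_iInter.2 fun s => ?_⟩
      have h1 : y ∈ {y | y ∈ Y ∧ rnd ν s y ≤ N k s ∧ (rnd ν s y)⁻¹ ≤ N k s} := by
        by_contra h2
        exact hno (Set.mem_iUnion.2 ⟨s, hy.1, h2⟩)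
      exact ⟨h1.2.1.trans (hNΘ k s), h1.2.2.trans (hNΘ k s)⟩
    exact (measure_mono hincl).trans ((measure_iUnion_le _).trans
      ((ENNReal.tsum_le_tsum fun s => (hN k s).le).trans (hδ k).le))

variable [MeasurableConstSMul Γ X]

/-- By symmetry of `T`, the flow from `B` to `A` consists of the `s`-translates of the flow from `A`
to `B`, and translation by `s` enlarges measure by at most `Θ` there. -/
lemma crossing_le_of_rnd_le {ν : Measure X} [SigmaFinite ν] (hΓ : MeasureClassPreserving Γ ν)
    {T : Finset Γ} (hT : ∀ s ∈ T, s⁻¹ ∈ T) {A B : Set X} (hA : MeasurableSet A)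
    (hB : MeasurableSet B) {Θ : ℝ≥0} (hΘ : ∀ y ∈ A, ∀ s ∈ T, rnd ν s y ≤ Θ) :
    crossing ν T A B ≤ (1 + Θ) * ∑ s ∈ T, ν (A ∩ (fun x => s • x) ⁻¹' B) := by
  rw [crossing, Finset.sum_add_distrib, add_mul, one_mul]
  gcongr
  have hre : ∑ s ∈ T, ν (B ∩ (fun x => s • x) ⁻¹' A) =
      ∑ s ∈ T, ν (B ∩ (fun x => s⁻¹ • x) ⁻¹' A) := by
    refine Finset.sum_bij' (fun s _ => s⁻¹) (fun s _ => s⁻¹) (fun s hs => hT s hs)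
      (fun s hs => hT s hs) ?_ ?_ ?_ <;> simp
  rw [hre, Finset.mul_sum]
  refine Finset.sum_le_sum fun s hs => ?_
  have hE : MeasurableSet (A ∩ (fun x => s • x) ⁻¹' B) :=
    hA.inter (measurable_const_smul s hB)
  have hpre : B ∩ (fun x => s⁻¹ • x) ⁻¹' A =
      (fun x => s⁻¹ • x) ⁻¹' (A ∩ (fun x => s • x) ⁻¹' B) := by
    ext x
    simp [and_comm]
  rw [hpre, ← hΓ.setLIntegral_rnd s hE, ← setLIntegral_const]
  refine setLIntegral_mono measurable_const fun x hx => ?_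
  exact_mod_cast hΘ x hx.1 s hs

lemma IsIsoperimetric.exists_isDomainOfMarkovExpansionFor {ν : Measure X} [SigmaFinite ν]
    (hΓ : MeasureClassPreserving Γ ν) {S : Finset Γ} {K : ℝ≥0∞} {Z : Set X}
    (h : IsIsoperimetric ν S K Z) (hK : K ≠ ∞) (hZ : IsMeasureDomain ν Z)
    (hbd : ∀ s : Γ, ∃ θ : ℝ≥0, ∀ y ∈ Z, rnd ν s y ≤ θ ∧ (rnd ν s y)⁻¹ ≤ θ) :
    ∃ (T : Finset Γ) (Θ : ℝ≥0), IsDomainOfMarkovExpansionFor ν T Z ∧ 1 ≤ Θ ∧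
      ∀ y ∈ Z, ∀ s ∈ T, rnd ν s y ≤ Θ ∧ (rnd ν s y)⁻¹ ≤ Θ := by
  classical
  choose θ hθ using hbd
  let T : Finset Γ := insert 1 (S ∪ S.image (·⁻¹))
  have hST : S ⊆ T := Finset.subset_union_left.trans (Finset.subset_insert _ _)
  have h1T : (1 : Γ) ∈ T := Finset.mem_insert_self _ _
  have hT : ∀ s ∈ T, s⁻¹ ∈ T := by
    intro s hs
    simp only [T, Finset.mem_insert, Finset.mem_union, Finset.mem_image] at hs ⊢
    rcases hs with rfl | hs | ⟨t, ht, rfl⟩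
    · simp
    · exact Or.inr (Or.inr ⟨s, hs, rfl⟩)
    · exact Or.inr (Or.inl (by simpa using ht))
  set Θ : ℝ≥0 := 1 + ∑ s ∈ T, θ s with hΘdef
  have hΘ1 : 1 ≤ Θ := le_self_add
  have hΘ : ∀ y ∈ Z, ∀ s ∈ T, rnd ν s y ≤ Θ ∧ (rnd ν s y)⁻¹ ≤ Θ := by
    intro y hy s hs
    have hle : θ s ≤ Θ := (Finset.single_le_sum (fun _ _ => zero_le) hs).trans le_add_self
    exact ⟨(hθ s y hy).1.trans hle, (hθ s y hy).2.trans hle⟩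
  have hsqrt_le : ∀ y ∈ Z, ∀ s ∈ T, NNReal.sqrt (rnd ν s y) ≤ Θ := by
    intro y hy s hs
    rw [NNReal.sqrt_le_iff_le_sq]
    exact (hΘ y hy s hs).1.trans (le_self_pow₀ hΘ1 two_ne_zero)
  have hle_sqrt : ∀ y ∈ Z, ∀ s ∈ T, Θ⁻¹ ≤ NNReal.sqrt (rnd ν s y) := by
    intro y hy s hs
    rw [NNReal.le_sqrt_iff_sq_le]
    refine (pow_le_of_le_one zero_le (inv_le_one_of_one_le₀ hΘ1) two_ne_zero).trans ?_
    exact inv_le_of_inv_le₀ (rnd_pos ν s y) (hΘ y hy s hs).2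
  refine ⟨T, Θ, ⟨hZ, h1T, hT, ?_⟩, hΘ1, hΘ⟩
  set m := reversingMeasure ν Z T with hm
  have hmle : ∀ A, MeasurableSet A → A ⊆ Z → m (Subtype.val ⁻¹' A) ≤ (T.card * Θ : ℝ≥0∞) * ν A := by
    intro A hA hAZ
    rw [hm, reversingMeasure_preimage ν hZ.1 T hA hAZ, ← setLIntegral_const]
    refine setLIntegral_mono measurable_const fun x hx => ?_
    have : sigma ν Z T x ≤ T.card * Θ := by
      rw [sigma_eq, ← nsmul_eq_mul]
      refine Finset.sum_le_card_nsmul _ _ _ fun s hs => ?_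
      split_ifs
      · exact hsqrt_le x (hAZ hx) s hs
      · exact zero_le
    exact_mod_cast this
  -- Here `T.card * Θ` bounds `σ`, `K` is the isoperimetric constant, `1 + Θ` makes the crossing
  -- one-directional, and the last `Θ` inserts the weight `√r ≥ Θ⁻¹`.
  set L : ℝ≥0∞ := T.card * Θ * (K * ((1 + Θ) * Θ)) with hL
  have hLtop : L ≠ ∞ := by
    rw [hL]
    finiteness
  have hmax0 : max L 1 ≠ 0 := (lt_max_of_lt_right one_pos).ne'
  have hmaxtop : max L 1 ≠ ∞ := (max_lt hLtop.lt_top ENNReal.one_lt_top).ne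
  refine (ENNReal.inv_pos.2 hmaxtop).trans_le ?_
  rw [cheegerConstant]
  refine le_iInf₂ ?_
  rintro A' ⟨hA', hpos, hhalf⟩
  obtain ⟨A₀, hA₀, rfl⟩ := hA'
  obtain ⟨A, hA, hAZ, hpre⟩ : ∃ A, MeasurableSet A ∧ A ⊆ Z ∧
      (Subtype.val ⁻¹' A₀ : Set Z) = Subtype.val ⁻¹' A :=
    ⟨A₀ ∩ Z, hA₀.inter hZ.1, Set.inter_subset_right, by ext x; simp⟩
  rw [hpre] at hpos hhalf ⊢
  have hfin : m (Subtype.val ⁻¹' A) ≠ ∞ := by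
    refine ((hmle A hA hAZ).trans_lt (ENNReal.mul_lt_top (by finiteness) ?_)).ne
    exact (measure_mono hAZ).trans_lt hZ.2.2
  rw [ENNReal.le_div_iff_mul_le (Or.inl hpos.ne') (Or.inl hfin), mul_comm, ← div_eq_mul_inv]
  refine ENNReal.div_le_of_le_mul' ?_
  have hBm : MeasurableSet (Z \ A) := hZ.1.diff hA
  have hcompl : (Subtype.val ⁻¹' A : Set Z)ᶜ = Subtype.val ⁻¹' (Z \ A) := by ext x; simp
  have hAB : m (Subtype.val ⁻¹' A) ≤ m (Subtype.val ⁻¹' (Z \ A)) := by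
    have hsum := measure_add_measure_compl (μ := m) (s := Subtype.val ⁻¹' A)
      (measurable_subtype_coe hA)
    rw [ENNReal.le_div_iff_mul_le (by simp) (by simp), mul_two, ← hsum, hcompl] at hhalf
    exact ENNReal.le_of_add_le_add_left hfin hhalf
  have hedge : ∑ s ∈ T, ν (A ∩ (fun x => s • x) ⁻¹' (Z \ A)) ≤
      Θ * boundarySize (localKernel ν hZ.1 T) m (Subtype.val ⁻¹' A) := by
    rw [hm, boundarySize_localKernel ν hZ.1 h1T hA hAZ, Finset.mul_sum]
    refine Finset.sum_le_sum fun s hs => ?_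
    have hE : MeasurableSet (A ∩ (fun x => s • x) ⁻¹' (Z \ A)) :=
      hA.inter (measurable_const_smul s hBm)
    rw [← lintegral_const_mul' _ _ ENNReal.coe_ne_top, ← setLIntegral_one]
    refine setLIntegral_mono' hE fun x hx => ?_
    have h1 : 1 ≤ Θ * NNReal.sqrt (rnd ν s x) := by
      rw [← mul_inv_cancel₀ (one_pos.trans_le hΘ1).ne']
      exact mul_le_mul_right (hle_sqrt x (hAZ hx.1) s hs) Θ
    exact_mod_cast h1
  have hcross : crossing ν S A (Z \ A) ≤
      (1 + Θ) * (Θ * boundarySize (localKernel ν hZ.1 T) m (Subtype.val ⁻¹' A)) := by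
    refine (crossing_mono ν hST subset_rfl subset_rfl).trans
      ((crossing_le_of_rnd_le hΓ hT hA hBm fun y hy s hs => (hΘ y (hAZ hy) s hs).1).trans ?_)
    gcongr
  have hLle : m (Subtype.val ⁻¹' A) ≤
      L * boundarySize (localKernel ν hZ.1 T) m (Subtype.val ⁻¹' A) := by
    have hfinal : ∀ {t : ℝ≥0∞}, t ≤ K * crossing ν S A (Z \ A) → (T.card * Θ : ℝ≥0∞) * t ≤
        L * boundarySize (localKernel ν hZ.1 T) m (Subtype.val ⁻¹' A) := by
      intro t ht
      refine (mul_le_mul_right (ht.trans (mul_le_mul_right hcross K)) _).trans_eq ?_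
      rw [hL]
      ring
    rcases h A hA hAZ with hcase | hcase
    · exact (hmle A hA hAZ).trans (hfinal hcase)
    -- If isoperimetry bounds the complement instead, `A` is still controlled, having at most half
    -- of the reversing measure.
    · exact hAB.trans ((hmle _ hBm Set.sdiff_subset).trans (hfinal hcase))
  exact hLle.trans (mul_le_mul_left (le_max_left _ _) _)

lemma StronglyErgodic.exists_exhaustion [Countable Γ] {ν : Measure X} [SigmaFinite ν]
    (hΓ : MeasureClassPreserving Γ ν) (h : StronglyErgodic Γ ν) {Y : Set X}
    (hY : IsMeasureDomain ν Y) :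
    ∃ (Z : ℕ → Set X) (S : ℕ → Finset Γ) (Θ : ℕ → ℝ≥0), IsExhaustion ν Y Z ∧
      ∀ n, IsDomainOfMarkovExpansionFor ν (S n) (Z n) ∧ 1 ≤ Θ n ∧
        ∀ y ∈ Z n, ∀ s ∈ S n, rnd ν s y ≤ Θ n ∧ (rnd ν s y)⁻¹ ≤ Θ n := by
  -- Each `W k` below misses at most `2 * η k ≤ 2 * w` of `Y`, so any two of them overlap in measure
  -- at least `4 * w`. Also `3 * η k ≤ 7 * w ≤ ν (V k)`, as trimming requires.
  obtain ⟨w, hw0, hw⟩ : ∃ w : ℝ≥0, 0 < w ∧ ν Y = 8 * (w : ℝ≥0∞) := by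
    refine ⟨(ν Y).toNNReal / 8, div_pos (ENNReal.toNNReal_pos hY.2.1.ne' hY.2.2.ne) (by norm_num),
      ?_⟩
    nth_rw 1 [← ENNReal.coe_toNNReal hY.2.2.ne]
    norm_cast
    field_simp
  let η : ℕ → ℝ≥0 := fun k => w / (k + 1)
  have hη0 : ∀ k, 0 < η k := fun k => div_pos hw0 (by positivity)
  have hηw : ∀ k, η k ≤ w := fun k => div_le_self zero_le (by simp)
  have hηlim : Tendsto (fun k => ((η k : ℝ≥0) : ℝ≥0∞) + η k) atTop (𝓝 0) := by
    have h1 : Tendsto η atTop (𝓝 0) := by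
      have := (tendsto_one_div_add_atTop_nhds_zero_nat (𝕜 := ℝ≥0)).const_mul w
      simpa [η, div_eq_mul_inv] using this
    have h2 := ENNReal.tendsto_coe.2 h1
    simpa using h2.add h2
  obtain ⟨V, θ, hVm, hVmono, hVY, hVη, hVθ⟩ :=
    exists_exhaustion_rnd_bounded (Γ := Γ) ν hY (η := fun k => (η k : ℝ≥0∞))
      fun k => by exact_mod_cast (hη0 k).ne'
  have hgood : ∀ k, ∃ W, MeasurableSet W ∧ W ⊆ V k ∧ ν (Y \ W) ≤ (η k : ℝ≥0∞) + η k ∧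
      ∃ (S : Finset Γ) (K : ℝ≥0∞), K ≠ ∞ ∧ IsIsoperimetric ν S K W := by
    intro k
    have hVfin : ν (V k) < ∞ := (measure_mono (hVY k)).trans_lt hY.2.2
    have h3 : 3 * (η k : ℝ≥0∞) ≤ ν (V k) := by
      have h4 : ν Y ≤ ν (Y \ V k) + ν (V k) := by
        rw [add_comm]
        refine (measure_mono ?_).trans (measure_union_le _ _)
        rw [Set.union_sdiff_self]
        exact Set.subset_union_right
      have h5 := h4.trans (add_le_add_left (hVη k) _)
      rw [hw, ← ENNReal.coe_toNNReal hVfin.ne] at h5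
      rw [← ENNReal.coe_toNNReal hVfin.ne]
      norm_cast at h5 ⊢
      have h6 := hηw k
      rw [← NNReal.coe_le_coe] at *
      push_cast at *
      linarith [w.coe_nonneg]
    have hVdom : IsMeasureDomain ν (V k) := by
      refine ⟨hVm k, lt_of_lt_of_le ?_ h3, hVfin⟩
      exact ENNReal.mul_pos (by norm_num) (by exact_mod_cast (hη0 k).ne')
    obtain ⟨S, c, hc, hS⟩ := h.exists_le_crossing hΓ hVdom (a := η k)
      (by exact_mod_cast (hη0 k).ne')
    obtain ⟨E, hE, hEV, hEη, K, hK, hiso⟩ := exists_isIsoperimetric_sdiff hVdom h3 hc hS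
    refine ⟨V k \ E, (hVm k).diff hE, Set.sdiff_subset, ?_, S, K, hK, hiso⟩
    have hincl : Y \ (V k \ E) ⊆ (Y \ V k) ∪ E := by
      intro x hx
      by_cases h1 : x ∈ V k
      · exact Or.inr (by_contra fun h2 => hx.2 ⟨h1, h2⟩)
      · exact Or.inl ⟨hx.1, h1⟩
    exact (measure_mono hincl).trans ((measure_union_le _ _).trans (add_le_add (hVη k) hEη.le))
  choose W hWm hWV hWη hWiso using hgood
  have hWY : ∀ k, W k ⊆ Y := fun k => (hWV k).trans (hVY k)
  -- The `W k` need not be nested; their finite unions are, and remain inside `V k`, where the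
  -- derivatives are bounded.
  let Z : ℕ → Set X := fun k => Set.accumulate W k
  have hZm : ∀ k, MeasurableSet (Z k) := fun k =>
    MeasurableSet.iUnion fun j => MeasurableSet.iUnion fun _ => hWm j
  have hZV : ∀ k, Z k ⊆ V k := fun k =>
    Set.iUnion₂_subset fun j hj => (hWV j).trans (hVmono hj)
  have hZY : ∀ k, Z k ⊆ Y := fun k => (hZV k).trans (hVY k)
  have hWZ : ∀ k, W k ⊆ Z k := fun k => Set.subset_accumulate
  have hYfin : ∀ A ⊆ Y, ν A ≠ ∞ := fun A hA => ((measure_mono hA).trans_lt hY.2.2).ne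
  have hoverlap : ∀ k l, ν (W k ∩ W l) ≠ 0 := by
    intro k l h0
    have hincl : Y ⊆ (W k ∩ W l) ∪ ((Y \ W k) ∪ (Y \ W l)) := by
      intro x hx
      by_cases h1 : x ∈ W k
      · by_cases h2 : x ∈ W l
        · exact Or.inl ⟨h1, h2⟩
        · exact Or.inr (Or.inr ⟨hx, h2⟩)
      · exact Or.inr (Or.inl ⟨hx, h1⟩)
    have h1 : ν Y ≤ 0 + (((η k : ℝ≥0∞) + η k) + ((η l : ℝ≥0∞) + η l)) :=
      (measure_mono hincl).trans ((measure_union_le _ _).trans (add_le_add h0.le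
        ((measure_union_le _ _).trans (add_le_add (hWη k) (hWη l)))))
    rw [hw, zero_add] at h1
    norm_cast at h1
    have h2 := hηw k
    have h3 := hηw l
    rw [← NNReal.coe_lt_coe] at hw0
    rw [← NNReal.coe_le_coe] at h1 h2 h3
    push_cast at *
    linarith
  have hZiso : ∀ k, ∃ (S : Finset Γ) (K : ℝ≥0∞), K ≠ ∞ ∧ IsIsoperimetric ν S K (Z k) := by
    classical
    intro k
    induction k with
    | zero =>
      have : Z 0 = W 0 := by simp [Z]
      rw [this]
      exact hWiso 0
    | succ k ih =>
      obtain ⟨S₁, K₁, hK₁, h₁⟩ := ih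
      obtain ⟨S₂, K₂, hK₂, h₂⟩ := hWiso (k + 1)
      obtain ⟨K, hK, hiso⟩ := h₁.union h₂ Finset.subset_union_left Finset.subset_union_right
        (hZm k) (hWm (k + 1)) hK₁ hK₂ (hYfin _ (hZY k)) (hYfin _ (hWY (k + 1)))
        (fun h0 => hoverlap k (k + 1) (measure_mono_null
          (Set.inter_subset_inter_left _ (hWZ k)) h0))
      refine ⟨S₁ ∪ S₂, K, hK, ?_⟩
      have : Z (k + 1) = Z k ∪ W (k + 1) := Set.accumulate_succ W k
      rwa [this]
  have hZdom : ∀ k, IsMeasureDomain ν (Z k) := by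
    refine fun k => ⟨hZm k, pos_iff_ne_zero.2 fun h0 => hoverlap k k ?_, (hYfin _ (hZY k)).lt_top⟩
    exact measure_mono_null (Set.inter_subset_left.trans (hWZ k)) h0
  choose S Θ hS hΘ1 hΘ using fun k => (hZiso k).elim fun S hS => hS.elim fun K hK =>
    hK.2.exists_isDomainOfMarkovExpansionFor hΓ hK.1 (hZdom k)
      fun s => ⟨θ k s, fun y hy => hVθ k y (hZV k hy) s⟩
  refine ⟨Z, S, Θ, ⟨hZm, Set.monotone_accumulate, hZY, ?_⟩, fun n => ⟨hS n, hΘ1 n, hΘ n⟩⟩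
  refine le_antisymm (ge_of_tendsto' hηlim fun k => ?_) zero_le
  refine (measure_mono (Set.sdiff_subset_sdiff_right ?_)).trans (hWη k)
  exact (hWZ k).trans (Set.subset_iUnion Z k)

end Exhaustion

end MarkovExpansion

theorem theoremD {Γ X : Type*} [Group Γ] [Countable Γ] [MeasurableSpace X] [MulAction Γ X]
    [MeasurableConstSMul Γ X] (ν : Measure X) [SigmaFinite ν] (hν : ν ≠ 0)
    (hΓ : MarkovExpansion.MeasureClassPreserving Γ ν) :
    (MarkovExpansion.StronglyErgodic Γ ν ↔
      ∀ Y : Set X, MarkovExpansion.IsMeasureDomain ν Y →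
        ∃ Z : ℕ → Set X, MarkovExpansion.IsExhaustion ν Y Z ∧
          ∀ n, MarkovExpansion.IsDomainOfMarkovExpansion Γ ν (Z n)) ∧
    (MarkovExpansion.StronglyErgodic Γ ν →
      ∀ Y : Set X, MarkovExpansion.IsMeasureDomain ν Y →
        ∃ (Z : ℕ → Set X) (S : ℕ → Finset Γ) (Θ : ℕ → ℝ),
          MarkovExpansion.IsExhaustion ν Y Z ∧
          ∀ n, MarkovExpansion.IsDomainOfMarkovExpansionFor ν (S n) (Z n) ∧ 1 ≤ Θ n ∧
            ∀ y ∈ Z n, ∀ s ∈ MarkovExpansion.localSet (Z n) (S n) y,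
              1 / Θ n ≤ (MarkovExpansion.rnd ν s y : ℝ) ∧
                (MarkovExpansion.rnd ν s y : ℝ) ≤ Θ n) ∧
    (IsProbabilityMeasure ν →
      (MarkovExpansion.StronglyErgodic Γ ν ↔ MarkovExpansion.AsymptoticallyExpanding Γ ν)) := by
  refine ⟨⟨fun h Y hY => ?_, MarkovExpansion.stronglyErgodic_of_exhaustions hν hΓ⟩,
    fun h Y hY => ?_, fun hprob => ⟨fun h => h.asymptoticallyExpanding hΓ,
      fun h => h.stronglyErgodic⟩⟩
  · obtain ⟨Z, S, _, hZ, hZS⟩ := h.exists_exhaustion hΓ hY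
    exact ⟨Z, hZ, fun n => ⟨S n, (hZS n).1⟩⟩
  · obtain ⟨Z, S, Θ, hZ, hS⟩ := h.exists_exhaustion hΓ hY
    refine ⟨Z, S, fun n => Θ n, hZ, fun n => ⟨(hS n).1, by exact_mod_cast (hS n).2.1,
      fun y hy s hs => ?_⟩⟩
    simp only [MarkovExpansion.localSet, Finset.mem_filter] at hs
    obtain ⟨h1, h2⟩ := (hS n).2.2 y hy s hs.1
    refine ⟨?_, by exact_mod_cast h1⟩
    rw [one_div]
    exact_mod_cast inv_le_of_inv_le₀ (MarkovExpansion.rnd_pos ν s y) h2
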